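/- **Definitions.** A $k$-graph is a $k$-uniform hypergraph, and $K_n^{(k)}$ is the complete $k$-graph on $n$ vertices. A $k$-graph $H$ is $F$-free if it contains no (not necessarily induced) subgraph isomorphic to $F$. Let $\alpha_F(H)$ be the largest size of a set $S\subseteq V(H)$ for which the induced subgraph $H[S]$ is $F$-free. The generalized Erdős–Rogers function is $$f^{(k)}_{F,s}(N)=\min\{\alpha_F(H): |V(H)|=N,\ H \text{ is a } K_s^{(k)}\text{-free } k\text{-graph}\}.$$ Let $5^-$ denote the $4$-graph obtained from $K_5^{(4)}$ by deleting one edge. Logarithms are to base $2$. **Theorem 1.1.** We have $f^{(4)}_{5^-,6}(N)=(\log\log N)^{\Theta(1)}$; that is, there are constants $a,b>0$ such that for all sufficiently large $N$, $$(\log\log N)^{a}\le f^{(4)}_{5^-,6}(N)\le(\log\log N)^{b}.$$ Moreover, there is an absolute constant $c>0$ such that for every integer $n\ge 5$ there is a $K_6^{(4)}$-free $4$-graph $H$ on $2^{\lfloor 2^{cn}\rfloor}$ vertices with $\alpha_{5^-}(H)<2^5n^5+1$. -/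

import Mathlib

/-- A `k`-uniform hypergraph (`k`-graph) with vertex set `V`: a collection of `k`-element
subsets of `V`. -/
structure KGraph (k : ℕ) (V : Type*) where
  /-- The set of edges. -/
  edges : Set (Finset V)
  /-- Every edge has exactly `k` elements. -/
  card_eq : ∀ e ∈ edges, e.card = k

namespace KGraph

variable {k : ℕ} {V W : Type*}

/-- The complete `k`-graph `K_n^{(k)}` on `n` vertices. -/
def complete (k n : ℕ) : KGraph k (Fin n) where
  edges := {e | e.card = k}
  card_eq := fun _ he => he

/-- The `k`-graph obtained from `H` by deleting the edge `e`. -/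
def deleteEdge (H : KGraph k V) (e : Finset V) : KGraph k V where
  edges := H.edges \ {e}
  card_eq := fun e' he' => H.card_eq e' he'.1

/-- The `k`-graph `H[S]` induced by `H` on the vertex set `S`. -/
def induce (H : KGraph k V) (S : Finset V) : KGraph k {x : V // x ∈ S} where
  edges := {e | e.map (Function.Embedding.subtype (fun x => x ∈ S)) ∈ H.edges}
  card_eq := fun e he => by
    have h := H.card_eq _ he
    rwa [Finset.card_map] at h

/-- `H` contains a copy of `F`, i.e. a (not necessarily induced) subgraph isomorphic to `F`. -/
def ContainsCopy (H : KGraph k V) (F : KGraph k W) : Prop :=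
  ∃ φ : W ↪ V, ∀ e ∈ F.edges, e.map φ ∈ H.edges

/-- `H` is `F`-free. -/
def IsFree (H : KGraph k V) (F : KGraph k W) : Prop :=
  ¬ H.ContainsCopy F

/-- `α_F(H)`: the size of the largest `S ⊆ V(H)` such that `H[S]` contains no copy of `F`. -/
noncomputable def alpha [Fintype V] (F : KGraph k W) (H : KGraph k V) : ℕ :=
  sSup {m : ℕ | ∃ S : Finset V, S.card = m ∧ (H.induce S).IsFree F}

/-- The generalized Erdős–Rogers function `f^{(k)}_{F,G}(N)`: the minimum of `α_F(H)` over all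
`G`-free `k`-graphs `H` on `N` vertices. -/
noncomputable def erdosRogers {U : Type*} (F : KGraph k W) (G : KGraph k U) (N : ℕ) : ℕ :=
  sInf {m : ℕ | ∃ H : KGraph k (Fin N), H.IsFree G ∧ alpha F H = m}

/-- The `4`-graph `5⁻`: the complete `4`-graph on `5` vertices with one edge deleted. -/
def fiveMinus : KGraph 4 (Fin 5) :=
  (complete 4 5).deleteEdge {0, 1, 2, 3}

end KGraph

/-! Upper bound. The vertices are the numbers below `2 ^ D`, viewed as leaves of a binary tree.
Edges are 4-sets whose tree is a caterpillar, with branching digits a < b < c satisfying `Good`, a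
condition on a 2-colouring φ of pairs of digits and on whether the first two branchings go to the
same side. A K₆ would itself be a caterpillar, with digits a₁, ..., a₅ and directions d₁, ..., d₄.
Three equal directions i < j < k would force φ(aⱼ, a₅) to be both false and true, so the directions
pair up. The partner of d₄ gives φ(a₄, a₅) = false. The first member i of the other pair gives φ(aᵢ,
a₄) = φ(aᵢ, a₅) = true. This is exactly the pattern forbidden for opposite directions
(`not_forall_good`). So K₆-freeness holds for every φ. A set of more than (2n)⁵ vertices contains a
complete binary tree of height 6 or a one-sided comb with n teeth (`card_le_of_not_comb`). The tall
tree contains 5⁻ for every φ (`hasFiveMinus_of_rich`). The comb contains 5⁻ if every n digits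
contain a certain four-digit pattern of φ, and a random φ has this property for D as large as 2^(cn)
(`exists_coloring`). Lower bound. A K₆-free 4-graph has a large independent set by Ramsey's theorem.
Two Erdős–Rado steps from the binomial bound for pairs give a double exponential with exponent
polynomial in T (`arrow_four`). -/

namespace BinaryTree

/-! ### Caterpillars in the binary tree and K₆-freeness. -/

/-- The binary expansions of `x` and `y` first differ at digit `a`. -/
def Splits (x y a : ℕ) : Prop :=
  x.testBit a ≠ y.testBit a ∧ ∀ i < a, x.testBit i = y.testBit i

theorem Splits.symm {x y a : ℕ} (h : Splits x y a) : Splits y x a :=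
  ⟨h.1.symm, fun i hi => (h.2 i hi).symm⟩

theorem Splits.ne {x y a : ℕ} (h : Splits x y a) : x ≠ y := fun e => h.1 (by rw [e])

theorem Splits.eq {x y a b : ℕ} (h : Splits x y a) (h' : Splits x y b) : a = b := by
  rcases lt_trichotomy a b with hab | hab | hab
  · exact absurd (h'.2 a hab) h.1
  · exact hab
  · exact absurd (h.2 b hab) h'.1

theorem exists_splits {x y : ℕ} (h : x ≠ y) : ∃ a, Splits x y a := by
  classical
  have h' : ∃ i, x.testBit i ≠ y.testBit i := by
    by_contra! hc
    exact h (Nat.eq_of_testBit_eq hc)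
  exact ⟨Nat.find h', Nat.find_spec h', fun i hi => not_not.1 (Nat.find_min h' hi)⟩

/-- Digits take only two values, so two numbers that first leave `x` at `a` agree there as well. -/
theorem Splits.lt {x y z a b : ℕ} (hy : Splits x y a) (hz : Splits x z a) (h : Splits y z b) :
    a < b := by
  rcases lt_trichotomy a b with hab | hab | hab
  · exact hab
  · subst hab
    have h1 := hy.1
    have h2 := hz.1
    have h3 := h.1
    revert h1 h2 h3
    cases x.testBit a <;> cases y.testBit a <;> cases z.testBit a <;> simp
  · exact absurd ((hy.2 b hab).symm.trans (hz.2 b hab)) h.1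

theorem Splits.lt_of_lt_two_pow {x y a D : ℕ} (h : Splits x y a) (hx : x < 2 ^ D)
    (hy : y < 2 ^ D) : a < D := by
  by_contra! hc
  have hp : 2 ^ D ≤ 2 ^ a := Nat.pow_le_pow_right (by norm_num) hc
  exact h.1 (by rw [Nat.testBit_lt_two_pow (hx.trans_le hp), Nat.testBit_lt_two_pow (hy.trans_le hp)])

/-- The binary tree of `p, q, r, s` is a caterpillar, with branching digits `a`, `b` and `c`. -/
def Caterpillar (p q r s a b c : ℕ) : Prop :=
  Splits p q a ∧ Splits p r a ∧ Splits p s a ∧ Splits q r b ∧ Splits q s b ∧ Splits r s c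

/-- The condition which three branching digits of a caterpillar have to satisfy in an edge;
`same` says whether the first two branchings are to the same side. -/
def Good (φ : ℕ → ℕ → Bool) (same : Bool) (a b c : ℕ) : Prop :=
  if same then φ a c = true ∧ φ b c = false
  else ¬ (φ a b = true ∧ φ a c = true ∧ φ b c = false)

/-- The edges of the `4`-graph on `ℕ` given by a colouring `φ` of the pairs of digits. -/
def Edge (φ : ℕ → ℕ → Bool) (e : Finset ℕ) : Prop :=
  ∃ p q r s a b c, e = {p, q, r, s} ∧ Caterpillar p q r s a b c ∧
    Good φ (p.testBit a == q.testBit b) a b c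

theorem Caterpillar.lt {p q r s a b c : ℕ} (h : Caterpillar p q r s a b c) : a < b ∧ b < c := by
  obtain ⟨h1, h2, h3, h4, h5, h6⟩ := h
  exact ⟨h1.lt h2 h4, h4.lt h5 h6⟩

/-- A caterpillar can be read from its vertex set, up to exchanging the last two vertices. Hence
`Edge`, although existential, can be tested on any caterpillar ordering. -/
theorem Caterpillar.unique {p q r s a b c p' q' r' s' a' b' c' : ℕ}
    (h : Caterpillar p q r s a b c) (h' : Caterpillar p' q' r' s' a' b' c')
    (he : ({p, q, r, s} : Finset ℕ) = {p', q', r', s'}) :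
    p = p' ∧ q = q' ∧ a = a' ∧ b = b' ∧ c = c' := by
  obtain ⟨hab, hbc⟩ := h.lt
  obtain ⟨hab', hbc'⟩ := h'.lt
  obtain ⟨h1, h2, h3, h4, h5, h6⟩ := h
  obtain ⟨h1', h2', h3', h4', h5', h6'⟩ := h'
  have n1 := h1.ne
  have n2 := h2.ne
  have n3 := h3.ne
  have n4 := h4.ne
  have n5 := h5.ne
  have n6 := h6.ne
  have m1 := h1'.ne
  have m2 := h2'.ne
  have m3 := h3'.ne
  have m4 := h4'.ne
  have m5 := h5'.ne
  have m6 := h6'.ne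
  have key : ∀ x ∈ ({p', q', r', s'} : Finset ℕ), ∀ y ∈ ({p', q', r', s'} : Finset ℕ), x ≠ y →
      (x = p' ∨ y = p' → Splits x y a') ∧
      (x ≠ p' → y ≠ p' → (x = q' ∨ y = q' → Splits x y b') ∧
        (x ≠ q' → y ≠ q' → Splits x y c')) := by
    intro x hx y hy hxy
    simp only [Finset.mem_insert, Finset.mem_singleton] at hx hy
    have t1 := h1'.symm
    have t2 := h2'.symm
    have t3 := h3'.symm
    have t4 := h4'.symm
    have t5 := h5'.symm
    have t6 := h6'.symm
    clear h1 h2 h3 h4 h5 h6 n1 n2 n3 n4 n5 n6 he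
    rcases hx with rfl | rfl | rfl | rfl <;> rcases hy with rfl | rfl | rfl | rfl <;> grind
  rw [← he] at key
  have k1 := key p (by simp) q (by simp) n1
  have k2 := key p (by simp) r (by simp) n2
  have k3 := key p (by simp) s (by simp) n3
  have k4 := key q (by simp) r (by simp) n4
  have k5 := key q (by simp) s (by simp) n5
  have k6 := key r (by simp) s (by simp) n6
  have hp' : p' ∈ ({p, q, r, s} : Finset ℕ) := by rw [he]; simp
  have hq' : q' ∈ ({p, q, r, s} : Finset ℕ) := by rw [he]; simp
  simp only [Finset.mem_insert, Finset.mem_singleton] at hp' hq'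
  have hp : p = p' := by
    rcases hp' with hp' | hp' | hp' | hp'
    · exact hp'.symm
    · have e1 := h1.eq (k1.1 (Or.inr hp'.symm))
      have e2 := h4.eq (k4.1 (Or.inl hp'.symm))
      omega
    · have e1 := h2.eq (k2.1 (Or.inr hp'.symm))
      have e2 := h4.eq (k4.1 (Or.inr hp'.symm))
      omega
    · have e1 := h3.eq (k3.1 (Or.inr hp'.symm))
      have e2 := h5.eq (k5.1 (Or.inr hp'.symm))
      omega
  have ha : a = a' := h1.eq (k1.1 (Or.inl hp))
  subst hp
  have hq : q = q' := by
    rcases hq' with hq' | hq' | hq' | hq'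
    · exact absurd hq'.symm m1
    · exact hq'.symm
    · have e1 := h4.eq ((k4.2 n1.symm n2.symm).1 (Or.inr hq'.symm))
      have e2 := h6.eq ((k6.2 n2.symm n3.symm).1 (Or.inl hq'.symm))
      omega
    · have e1 := h5.eq ((k5.2 n1.symm n3.symm).1 (Or.inr hq'.symm))
      have e2 := h6.eq ((k6.2 n2.symm n3.symm).1 (Or.inr hq'.symm))
      omega
  refine ⟨rfl, hq, ha, h4.eq ((k4.2 n1.symm n2.symm).1 (Or.inl hq)), ?_⟩
  subst hq
  exact h6.eq ((k6.2 n2.symm n3.symm).2 n4.symm n5.symm)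

theorem Edge.good {φ : ℕ → ℕ → Bool} {p q r s a b c : ℕ} (h : Caterpillar p q r s a b c)
    (he : Edge φ {p, q, r, s}) : Good φ (p.testBit a == q.testBit b) a b c := by
  obtain ⟨p', q', r', s', a', b', c', he, h', hg⟩ := he
  obtain ⟨rfl, rfl, rfl, rfl, rfl⟩ := h.unique h' he
  exact hg

/-- At the first branching digit of `S` one side is a single point: two points from each side would
form a 4-set that is not a caterpillar. -/
theorem exists_splits_all {φ : ℕ → ℕ → Bool} {S : Finset ℕ} (hS : 2 ≤ S.card)
    (h : ∀ e ⊆ S, e.card = 4 → Edge φ e) : ∃ p ∈ S, ∃ a, ∀ q ∈ S.erase p, Splits p q a := by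
  classical
  have hex : ∃ a, ∃ x ∈ S, ∃ y ∈ S, Splits x y a := by
    obtain ⟨x, hx, y, hy, hxy⟩ := Finset.one_lt_card.1 (show 1 < S.card by omega)
    obtain ⟨a, ha⟩ := exists_splits hxy
    exact ⟨a, x, hx, y, hy, ha⟩
  obtain ⟨x₀, hx₀, y₀, hy₀, h₀⟩ := Nat.find_spec hex
  have hmin : ∀ {x y b : ℕ}, x ∈ S → y ∈ S → Splits x y b → Nat.find hex ≤ b :=
    fun hx hy hb => Nat.find_min' hex ⟨_, hx, _, hy, hb⟩
  generalize Nat.find hex = a at h₀ hmin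
  have hcross : ∀ {x y : ℕ}, x ∈ S → y ∈ S → x.testBit a ≠ y.testBit a → Splits x y a := by
    intro x y hx hy hxy
    obtain ⟨b, hb⟩ := exists_splits (x := x) (y := y) (fun e => hxy (by rw [e]))
    have := hmin hx hy hb
    exact ⟨hxy, fun i hi => hb.2 i (by omega)⟩
  by_cases h1 : ∃ p ∈ S, ∀ q ∈ S, q.testBit a = p.testBit a → q = p
  · obtain ⟨p, hp, hpq⟩ := h1
    refine ⟨p, hp, a, fun q hq => ?_⟩
    rw [Finset.mem_erase] at hq
    exact hcross hp hq.2 fun e => hq.1 (hpq q hq.2 e.symm)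
  · push Not at h1
    obtain ⟨x₁, hx₁, ex, nx⟩ := h1 x₀ hx₀
    obtain ⟨y₁, hy₁, ey, ny⟩ := h1 y₀ hy₀
    have hb := h₀.1
    have s1 := hcross hx₀ hy₀ hb
    have s2 := hcross hx₀ hy₁ (by rwa [ey])
    have s3 := hcross hx₁ hy₀ (by rwa [ex])
    have s4 := hcross hx₁ hy₁ (by rwa [ex, ey])
    have hcard : ({x₀, x₁, y₀, y₁} : Finset ℕ).card = 4 := by
      rw [Finset.card_eq_of_equiv_fin]
      exact (Finset.equivFinOfCardEq (by
        simp [Finset.card_insert_of_notMem, nx.symm, ny.symm, s1.ne, s2.ne, s3.ne, s4.ne]))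
    obtain ⟨p, q, r, s, a', b', c', he, hc, -⟩ := h {x₀, x₁, y₀, y₁} (by
      intro z hz
      simp only [Finset.mem_insert, Finset.mem_singleton] at hz
      rcases hz with rfl | rfl | rfl | rfl <;> assumption) hcard
    have hpe : ∀ z ∈ ({x₀, x₁, y₀, y₁} : Finset ℕ), z ≠ p → Splits p z a' := by
      intro z hz hzp
      rw [he] at hz
      obtain ⟨h1, h2, h3, -⟩ := hc
      simp only [Finset.mem_insert, Finset.mem_singleton] at hz
      rcases hz with rfl | rfl | rfl | rfl
      · exact absurd rfl hzp
      all_goals assumption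
    have hp : p ∈ ({x₀, x₁, y₀, y₁} : Finset ℕ) := by rw [he]; simp
    simp only [Finset.mem_insert, Finset.mem_singleton] at hp
    rcases hp with rfl | rfl | rfl | rfl
    · have e1 := s1.eq (hpe y₀ (by simp) s1.ne.symm)
      have e2 := hpe x₁ (by simp) nx
      exact absurd ex.symm (e1 ▸ e2.1)
    · have e1 := s3.eq (hpe y₀ (by simp) s3.ne.symm)
      have e2 := hpe x₀ (by simp) nx.symm
      exact absurd ex (e1 ▸ e2.1)
    · have e1 := s1.symm.eq (hpe x₀ (by simp) s1.ne)
      have e2 := hpe y₁ (by simp) ny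
      exact absurd ey.symm (e1 ▸ e2.1)
    · have e1 := s2.symm.eq (hpe x₀ (by simp) s2.ne)
      have e2 := hpe y₀ (by simp) ny.symm
      exact absurd ey (e1 ▸ e2.1)

theorem not_forall_good (φ : ℕ → ℕ → Bool) (d₁ d₂ d₃ d₄ : Bool) (a₁ a₂ a₃ a₄ a₅ : ℕ)
    (h₁₂₃ : Good φ (d₁ == d₂) a₁ a₂ a₃) (h₁₂₄ : Good φ (d₁ == d₂) a₁ a₂ a₄)
    (h₁₂₅ : Good φ (d₁ == d₂) a₁ a₂ a₅) (h₁₃₄ : Good φ (d₁ == d₃) a₁ a₃ a₄)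
    (h₁₃₅ : Good φ (d₁ == d₃) a₁ a₃ a₅) (h₁₄₅ : Good φ (d₁ == d₄) a₁ a₄ a₅)
    (h₂₃₄ : Good φ (d₂ == d₃) a₂ a₃ a₄) (h₂₃₅ : Good φ (d₂ == d₃) a₂ a₃ a₅)
    (h₂₄₅ : Good φ (d₂ == d₄) a₂ a₄ a₅) (h₃₄₅ : Good φ (d₃ == d₄) a₃ a₄ a₅) : False := by
  cases d₁ <;> cases d₂ <;> cases d₃ <;> cases d₄ <;> simp_all [Good]

theorem exists_not_edge (φ : ℕ → ℕ → Bool) {S : Finset ℕ} (hS : S.card = 6) :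
    ∃ e ⊆ S, e.card = 4 ∧ ¬ Edge φ e := by
  classical
  by_contra! h
  obtain ⟨p₁, hp₁, a₁, h₁⟩ := exists_splits_all (by omega) h
  have c₁ : (S.erase p₁).card = 5 := by rw [Finset.card_erase_of_mem hp₁, hS]
  have hsub₁ := Finset.erase_subset p₁ S
  obtain ⟨p₂, hp₂, a₂, h₂⟩ := exists_splits_all (S := S.erase p₁) (by omega)
    fun e he => h e (he.trans hsub₁)
  have c₂ : ((S.erase p₁).erase p₂).card = 4 := by rw [Finset.card_erase_of_mem hp₂, c₁]
  have hsub₂ := (Finset.erase_subset p₂ (S.erase p₁))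
  obtain ⟨p₃, hp₃, a₃, h₃⟩ := exists_splits_all (S := (S.erase p₁).erase p₂) (by omega)
    fun e he => h e (he.trans (hsub₂.trans hsub₁))
  have c₃ : (((S.erase p₁).erase p₂).erase p₃).card = 3 := by
    rw [Finset.card_erase_of_mem hp₃, c₂]
  have hsub₃ := (Finset.erase_subset p₃ ((S.erase p₁).erase p₂))
  obtain ⟨p₄, hp₄, a₄, h₄⟩ := exists_splits_all (S := ((S.erase p₁).erase p₂).erase p₃) (by omega)
    fun e he => h e (he.trans (hsub₃.trans (hsub₂.trans hsub₁)))
  have c₄ : ((((S.erase p₁).erase p₂).erase p₃).erase p₄).card = 2 := by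
    rw [Finset.card_erase_of_mem hp₄, c₃]
  have hsub₄ := (Finset.erase_subset p₄ (((S.erase p₁).erase p₂).erase p₃))
  obtain ⟨p₅, hp₅, p₆, hp₆, h₅₆⟩ := Finset.one_lt_card.1
    (show 1 < ((((S.erase p₁).erase p₂).erase p₃).erase p₄).card by omega)
  obtain ⟨a₅, h₅⟩ := exists_splits h₅₆
  have key : ∀ {p q r s a b c}, Caterpillar p q r s a b c → p ∈ S → q ∈ S → r ∈ S → s ∈ S →
      Good φ (p.testBit a == q.testBit b) a b c := by
    intro p q r s a b c hc hp hq hr hs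
    refine Edge.good hc (h _ ?_ ?_)
    · intro z hz
      simp only [Finset.mem_insert, Finset.mem_singleton] at hz
      rcases hz with rfl | rfl | rfl | rfl <;> assumption
    · obtain ⟨h1, h2, h3, h4, h5, h6⟩ := hc
      simp [Finset.card_insert_of_notMem, h1.ne, h2.ne, h3.ne, h4.ne, h5.ne, h6.ne]
  have m₅ := hsub₄ hp₅
  have m₆ := hsub₄ hp₆
  have n₄ := hsub₃ hp₄
  have n₅ := hsub₃ m₅
  have n₆ := hsub₃ m₆
  have o₃ := hsub₂ hp₃
  have o₄ := hsub₂ n₄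
  have o₅ := hsub₂ n₅
  have o₆ := hsub₂ n₆
  have q₂ := hsub₁ hp₂
  have q₃ := hsub₁ o₃
  have q₄ := hsub₁ o₄
  have q₅ := hsub₁ o₅
  have q₆ := hsub₁ o₆
  -- Every quadruple ends in `p₆`, so the ten triples of branching digits are all realised; only the
  -- first four digits need a direction.
  refine not_forall_good φ (p₁.testBit a₁) (p₂.testBit a₂) (p₃.testBit a₃) (p₄.testBit a₄)
    a₁ a₂ a₃ a₄ a₅ ?_ ?_ ?_ ?_ ?_ ?_ ?_ ?_ ?_ ?_
  · exact key ⟨h₁ _ hp₂, h₁ _ o₃, h₁ _ o₆, h₂ _ hp₃, h₂ _ n₆, h₃ _ m₆⟩ hp₁ q₂ q₃ q₆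
  · exact key ⟨h₁ _ hp₂, h₁ _ o₄, h₁ _ o₆, h₂ _ n₄, h₂ _ n₆, h₄ _ hp₆⟩ hp₁ q₂ q₄ q₆
  · exact key ⟨h₁ _ hp₂, h₁ _ o₅, h₁ _ o₆, h₂ _ n₅, h₂ _ n₆, h₅⟩ hp₁ q₂ q₅ q₆
  · exact key ⟨h₁ _ o₃, h₁ _ o₄, h₁ _ o₆, h₃ _ hp₄, h₃ _ m₆, h₄ _ hp₆⟩ hp₁ q₃ q₄ q₆
  · exact key ⟨h₁ _ o₃, h₁ _ o₅, h₁ _ o₆, h₃ _ m₅, h₃ _ m₆, h₅⟩ hp₁ q₃ q₅ q₆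
  · exact key ⟨h₁ _ o₄, h₁ _ o₅, h₁ _ o₆, h₄ _ hp₅, h₄ _ hp₆, h₅⟩ hp₁ q₄ q₅ q₆
  · exact key ⟨h₂ _ hp₃, h₂ _ n₄, h₂ _ n₆, h₃ _ hp₄, h₃ _ m₆, h₄ _ hp₆⟩ q₂ q₃ q₄ q₆
  · exact key ⟨h₂ _ hp₃, h₂ _ n₅, h₂ _ n₆, h₃ _ m₅, h₃ _ m₆, h₅⟩ q₂ q₃ q₅ q₆
  · exact key ⟨h₂ _ n₄, h₂ _ n₅, h₂ _ n₆, h₄ _ hp₅, h₄ _ hp₆, h₅⟩ q₂ q₄ q₅ q₆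
  · exact key ⟨h₃ _ hp₄, h₃ _ m₅, h₃ _ m₆, h₄ _ hp₅, h₄ _ hp₆, h₅⟩ q₃ q₄ q₅ q₆

/-! ### Copies of 5⁻ on five caterpillar points. -/

/-- `S` contains five points which span at least four edges. -/
def HasFiveMinus (φ : ℕ → ℕ → Bool) (S : Finset ℕ) : Prop :=
  ∃ x : Fin 5 → ℕ, Function.Injective x ∧ (∀ i, x i ∈ S) ∧
    Edge φ {x 0, x 1, x 2, x 4} ∧ Edge φ {x 0, x 1, x 3, x 4} ∧
    Edge φ {x 0, x 2, x 3, x 4} ∧ Edge φ {x 1, x 2, x 3, x 4}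

theorem insert_rotate' (a b c d : ℕ) : ({a, b, c, d} : Finset ℕ) = {a, d, b, c} := by
  ext; simp; tauto

theorem insert_rotate (a b c d : ℕ) : ({a, b, c, d} : Finset ℕ) = {d, a, b, c} := by
  ext; simp; tauto

/-- The triple (a₁, a₂, a₃) yields two edges, since the fourth vertex may be `p₄` or `p₅`. Each
other triple yields one, so two more good triples complete four edges. The vertex common to all four
plays the role of `x 4`. -/
theorem hasFiveMinus_of_caterpillar {φ : ℕ → ℕ → Bool} {S : Finset ℕ}
    {p₁ p₂ p₃ p₄ p₅ a₁ a₂ a₃ a₄ : ℕ}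
    (m₁ : p₁ ∈ S) (m₂ : p₂ ∈ S) (m₃ : p₃ ∈ S) (m₄ : p₄ ∈ S) (m₅ : p₅ ∈ S)
    (s₁₂ : Splits p₁ p₂ a₁) (s₁₃ : Splits p₁ p₃ a₁) (s₁₄ : Splits p₁ p₄ a₁)
    (s₁₅ : Splits p₁ p₅ a₁) (s₂₃ : Splits p₂ p₃ a₂) (s₂₄ : Splits p₂ p₄ a₂)
    (s₂₅ : Splits p₂ p₅ a₂) (s₃₄ : Splits p₃ p₄ a₃) (s₃₅ : Splits p₃ p₅ a₃)
    (s₄₅ : Splits p₄ p₅ a₄)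
    (g : Good φ (p₁.testBit a₁ == p₂.testBit a₂) a₁ a₂ a₃)
    (g' : Good φ (p₁.testBit a₁ == p₂.testBit a₂) a₁ a₂ a₄ ∧
        Good φ (p₁.testBit a₁ == p₃.testBit a₃) a₁ a₃ a₄ ∨
      Good φ (p₁.testBit a₁ == p₂.testBit a₂) a₁ a₂ a₄ ∧
        Good φ (p₂.testBit a₂ == p₃.testBit a₃) a₂ a₃ a₄ ∨
      Good φ (p₁.testBit a₁ == p₃.testBit a₃) a₁ a₃ a₄ ∧
        Good φ (p₂.testBit a₂ == p₃.testBit a₃) a₂ a₃ a₄) :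
    HasFiveMinus φ S := by
  have e1 : Edge φ {p₁, p₂, p₃, p₄} := ⟨_, _, _, _, _, _, _, rfl, ⟨s₁₂, s₁₃, s₁₄, s₂₃, s₂₄, s₃₄⟩, g⟩
  have e2 : Edge φ {p₁, p₂, p₃, p₅} := ⟨_, _, _, _, _, _, _, rfl, ⟨s₁₂, s₁₃, s₁₅, s₂₃, s₂₅, s₃₅⟩, g⟩
  have e3 : Good φ (p₁.testBit a₁ == p₂.testBit a₂) a₁ a₂ a₄ → Edge φ {p₁, p₂, p₄, p₅} :=
    fun g => ⟨_, _, _, _, _, _, _, rfl, ⟨s₁₂, s₁₄, s₁₅, s₂₄, s₂₅, s₄₅⟩, g⟩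
  have e4 : Good φ (p₁.testBit a₁ == p₃.testBit a₃) a₁ a₃ a₄ → Edge φ {p₁, p₃, p₄, p₅} :=
    fun g => ⟨_, _, _, _, _, _, _, rfl, ⟨s₁₃, s₁₄, s₁₅, s₃₄, s₃₅, s₄₅⟩, g⟩
  have e5 : Good φ (p₂.testBit a₂ == p₃.testBit a₃) a₂ a₃ a₄ → Edge φ {p₂, p₃, p₄, p₅} :=
    fun g => ⟨_, _, _, _, _, _, _, rfl, ⟨s₂₃, s₂₄, s₂₅, s₃₄, s₃₅, s₄₅⟩, g⟩
  have n := And.intro s₁₂.ne <| And.intro s₁₃.ne <| And.intro s₁₄.ne <| And.intro s₁₅.ne <|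
    And.intro s₂₃.ne <| And.intro s₂₄.ne <| And.intro s₂₅.ne <| And.intro s₃₄.ne <|
    And.intro s₃₅.ne s₄₅.ne
  have mk : ∀ x₀ x₁ x₂ x₃ x₄ : ℕ, [x₀, x₁, x₂, x₃, x₄].Nodup → x₀ ∈ S → x₁ ∈ S → x₂ ∈ S →
      x₃ ∈ S → x₄ ∈ S → Edge φ {x₀, x₁, x₂, x₄} → Edge φ {x₀, x₁, x₃, x₄} →
      Edge φ {x₀, x₂, x₃, x₄} → Edge φ {x₁, x₂, x₃, x₄} → HasFiveMinus φ S := by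
    intro x₀ x₁ x₂ x₃ x₄ hn h0 h1 h2 h3 h4 f1 f2 f3 f4
    refine ⟨![x₀, x₁, x₂, x₃, x₄], ?_, ?_, f1, f2, f3, f4⟩
    · exact List.nodup_ofFn.1 (show (List.ofFn ![x₀, x₁, x₂, x₃, x₄]).Nodup by
        simpa [List.ofFn_succ] using hn)
    · intro i
      fin_cases i <;> simpa
  obtain ⟨n1, n2, n3, n4, n5, n6, n7, n8, n9, n10⟩ := n
  rcases g' with ⟨h, h'⟩ | ⟨h, h'⟩ | ⟨h, h'⟩
  · refine mk p₂ p₃ p₄ p₅ p₁ (by simp [*, n1.symm, n2.symm, n3.symm, n4.symm]) m₂ m₃ m₄ m₅ m₁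
      ?_ ?_ ?_ ?_
    · rwa [insert_rotate]
    · rwa [insert_rotate]
    · rw [insert_rotate]; exact e3 h
    · rw [insert_rotate]; exact e4 h'
  · refine mk p₁ p₃ p₄ p₅ p₂ (by simp [*, n5.symm, n6.symm, n7.symm]) m₁ m₃ m₄ m₅ m₂ ?_ ?_ ?_ ?_
    · rwa [insert_rotate']
    · rwa [insert_rotate']
    · rw [insert_rotate']; exact e3 h
    · rw [insert_rotate]; exact e5 h'
  · refine mk p₁ p₂ p₄ p₅ p₃ (by simp [*, n8.symm, n9.symm]) m₁ m₂ m₄ m₅ m₃ ?_ ?_ ?_ ?_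
    · rwa [Finset.pair_comm]
    · rwa [Finset.pair_comm]
    · rw [insert_rotate']; exact e4 h
    · rw [insert_rotate']; exact e5 h'

end BinaryTree

/-! ### Complete binary trees and combs inside a vertex set. -/

namespace BinaryTree

/-- `T false` and `T true` are nonempty subsets of `S` on the two sides of a branching of `S` at
digit `a`. -/
structure Node (a : ℕ) (T : Bool → Finset ℕ) (S : Finset ℕ) : Prop where
  subset : ∀ b, T b ⊆ S
  nonempty : ∀ b, (T b).Nonempty
  testBit : ∀ b, ∀ x ∈ T b, x.testBit a = b
  splits : ∀ b, ∀ x ∈ T b, ∀ y ∈ T (!b), Splits x y a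

theorem Node.mono {a : ℕ} {T : Bool → Finset ℕ} {S S' : Finset ℕ} (h : Node a T S) (hS : S ⊆ S') :
    Node a T S' :=
  ⟨fun b => (h.subset b).trans hS, h.nonempty, h.testBit, h.splits⟩

/-- `S` contains a complete binary tree with `h` levels of branchings. -/
def Rich : ℕ → Finset ℕ → Prop
  | 0, S => S.Nonempty
  | h + 1, S => ∃ a T, Node a T S ∧ ∀ b, Rich h (T b)

theorem Rich.nonempty {h : ℕ} {S : Finset ℕ} (hS : Rich h S) : S.Nonempty := by
  cases h with
  | zero => exact hS
  | succ h =>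
    obtain ⟨a, T, hT, -⟩ := hS
    exact (hT.nonempty true).mono (hT.subset true)

theorem Rich.mono {h : ℕ} {S S' : Finset ℕ} (hS : Rich h S) (hSS : S ⊆ S') : Rich h S' := by
  cases h with
  | zero => exact Finset.Nonempty.mono hSS hS
  | succ h =>
    obtain ⟨a, T, hT, h'⟩ := hS
    exact ⟨a, T, hT.mono hSS, h'⟩

/-- Along a descending path of four nodes, take one point on the side left behind at each of the
first three and one point on each side of the last. These five points form a caterpillar; reversing
all directions does not affect which are equal. -/
theorem not_good_of_nodes {φ : ℕ → ℕ → Bool} {S : Finset ℕ} (hS : ¬ HasFiveMinus φ S)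
    {a₁ a₂ a₃ a₄ : ℕ} {T₁ T₂ T₃ T₄ : Bool → Finset ℕ} {d₁ d₂ d₃ : Bool}
    (h₁ : Node a₁ T₁ S) (h₂ : Node a₂ T₂ (T₁ d₁)) (h₃ : Node a₃ T₃ (T₂ d₂))
    (h₄ : Node a₄ T₄ (T₃ d₃)) (g : Good φ (d₁ == d₂) a₁ a₂ a₃) :
    ¬ (Good φ (d₁ == d₂) a₁ a₂ a₄ ∧ Good φ (d₁ == d₃) a₁ a₃ a₄ ∨
      Good φ (d₁ == d₂) a₁ a₂ a₄ ∧ Good φ (d₂ == d₃) a₂ a₃ a₄ ∨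
      Good φ (d₁ == d₃) a₁ a₃ a₄ ∧ Good φ (d₂ == d₃) a₂ a₃ a₄) := by
  intro g'
  obtain ⟨p₁, m₁⟩ := h₁.nonempty (!d₁)
  obtain ⟨p₂, m₂⟩ := h₂.nonempty (!d₂)
  obtain ⟨p₃, m₃⟩ := h₃.nonempty (!d₃)
  obtain ⟨p₄, m₄⟩ := h₄.nonempty true
  obtain ⟨p₅, m₅⟩ := h₄.nonempty false
  have n₂ := h₂.subset _ m₂
  have n₃ := h₃.subset _ m₃
  have n₄ := h₄.subset _ m₄
  have n₅ := h₄.subset _ m₅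
  have o₃ := h₂.subset _ n₃
  have o₄ := h₃.subset _ n₄
  have o₅ := h₃.subset _ n₅
  have q₄ := h₂.subset _ o₄
  have q₅ := h₂.subset _ o₅
  have e : ∀ b b' : Bool, ((!b) == (!b')) = (b == b') := by decide
  refine hS (hasFiveMinus_of_caterpillar (h₁.subset _ m₁) (h₁.subset _ n₂) (h₁.subset _ o₃)
    (h₁.subset _ q₄) (h₁.subset _ q₅) (h₁.splits d₁ _ n₂ _ m₁).symm (h₁.splits d₁ _ o₃ _ m₁).symm
    (h₁.splits d₁ _ q₄ _ m₁).symm (h₁.splits d₁ _ q₅ _ m₁).symm (h₂.splits d₂ _ n₃ _ m₂).symm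
    (h₂.splits d₂ _ o₄ _ m₂).symm (h₂.splits d₂ _ o₅ _ m₂).symm (h₃.splits d₃ _ n₄ _ m₃).symm
    (h₃.splits d₃ _ n₅ _ m₃).symm (h₄.splits true _ m₄ _ m₅) ?_ ?_)
  · rwa [h₁.testBit _ _ m₁, h₂.testBit _ _ m₂, e]
  · rwa [h₁.testBit _ _ m₁, h₂.testBit _ _ m₂, h₃.testBit _ _ m₃, e, e, e]

/-- If φ(a₁, a₂) were false, every triple starting with a₁, a₂ would be good. On the path a₁, a₂,
a₃, a₄ the triples 134 and 234 must then both fail, which gives φ(a₃, a₄) = false and so excludes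
φ(a₂, a₄) = true. On the path a₁, a₂, a₄, a₅ the failure of 245 requires φ(a₂, a₄) = true. -/
theorem eq_true_of_nodes {φ : ℕ → ℕ → Bool} {S : Finset ℕ} (hS : ¬ HasFiveMinus φ S)
    {a₁ a₂ : ℕ} {T₁ T₂ : Bool → Finset ℕ} {d : Bool}
    (h₁ : Node a₁ T₁ S) (h₂ : Node a₂ T₂ (T₁ d)) (hr : Rich 3 (T₂ (!d))) : φ a₁ a₂ = true := by
  obtain ⟨a₃, T₃, h₃, r₃⟩ := hr
  obtain ⟨a₄, T₄, h₄, r₄⟩ := r₃ (!d)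
  obtain ⟨a₅, T₅, h₅, -⟩ := r₄ d
  have c₁ := not_good_of_nodes hS h₁ h₂ h₃ h₄
  have c₂ := not_good_of_nodes hS h₁ h₂ (h₄.mono (h₃.subset _)) h₅
  by_contra h
  revert c₁ c₂
  cases d <;> simp [Good, h] <;> grind

/-- If φ(a₂, a₄) were true, 123 and 124 would be good. Then 134 must fail, so φ(a₃, a₄) = false,
which makes 234 good: a contradiction. -/
theorem eq_true_eq_false_of_nodes {φ : ℕ → ℕ → Bool} {S : Finset ℕ} (hS : ¬ HasFiveMinus φ S)
    {a₁ a₂ a₃ a₄ : ℕ} {T₁ T₂ T₃ T₄ : Bool → Finset ℕ} {d : Bool}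
    (h₁ : Node a₁ T₁ S) (h₂ : Node a₂ T₂ (T₁ d)) (h₃ : Node a₃ T₃ (T₂ (!d)))
    (h₄ : Node a₄ T₄ (T₃ (!d))) (e₁₂ : φ a₁ a₂ = true) (e₁₃ : φ a₁ a₃ = true)
    (e₂₃ : φ a₂ a₃ = true) : φ a₂ a₄ = false := by
  have c := not_good_of_nodes hS h₁ h₂ h₃ h₄
  revert c
  cases d <;> simp [Good, *] <;> grind

theorem hasFiveMinus_of_rich {φ : ℕ → ℕ → Bool} {S : Finset ℕ} (h : Rich 6 S) :
    HasFiveMinus φ S := by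
  by_contra hS
  obtain ⟨a₁, T₁, h₁, r₁⟩ := h
  obtain ⟨a₂, T₂, h₂, r₂⟩ := r₁ true
  obtain ⟨a₃, T₃, h₃, r₃⟩ := r₂ false
  obtain ⟨a₄, T₄, h₄, r₄⟩ := r₃ false
  obtain ⟨a₅, T₅, h₅, r₅⟩ := r₄ true
  obtain ⟨a₆, T₆, h₆, -⟩ := r₅ true
  have h₂' := h₂.mono (h₁.subset _)
  have weaken : ∀ {X : Finset ℕ}, Rich 4 X → Rich 3 X := by
    rintro X ⟨a, T, hT, r⟩
    refine ⟨a, T, hT, fun b => ?_⟩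
    obtain ⟨a, T, hT, r⟩ := r b
    refine ⟨a, T, hT, fun b => ?_⟩
    obtain ⟨a, T, hT, r⟩ := r b
    exact ⟨a, T, hT, fun b => (r b).nonempty⟩
  have e₁₂ := eq_true_of_nodes hS h₁ h₂ (weaken (r₂ false))
  have e₁₃ := eq_true_of_nodes hS h₁ (h₃.mono (h₂.subset _)) (r₃ false)
  have e₂₃ := eq_true_of_nodes hS h₂' h₃ (r₃ true)
  have e₂₄ := eq_true_eq_false_of_nodes hS h₁ h₂ h₃ h₄ e₁₂ e₁₃ e₂₃
  have e₂₅ := eq_true_eq_false_of_nodes hS h₁ h₂ h₃ (h₅.mono (h₄.subset _)) e₁₂ e₁₃ e₂₃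
  -- On a₂, a₄, a₅, a₆ the first direction is opposite to the next two, and φ(a₂, a₄) = φ(a₂, a₅) =
  -- false makes 245, 246 and 256 good.
  have c := not_good_of_nodes hS h₂' (h₄.mono (h₃.subset _)) h₅ h₆
  revert c
  simp [Good, e₂₄, e₂₅]

/-- `S` contains a comb with `k` teeth, all of them to the side `b`. -/
def Comb (b : Bool) (k : ℕ) (S : Finset ℕ) : Prop :=
  ∃ (a p : ℕ → ℕ), (∀ i ≤ k, p i ∈ S) ∧ (∀ i < k, (p i).testBit (a i) = b) ∧
    ∀ i j, i < j → j ≤ k → Splits (p i) (p j) (a i)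

theorem Comb.mono {b : Bool} {k : ℕ} {S S' : Finset ℕ} (h : Comb b k S) (hS : S ⊆ S') :
    Comb b k S' := by
  obtain ⟨a, p, h1, h2⟩ := h
  exact ⟨a, p, fun i hi => hS (h1 i hi), h2⟩

theorem Comb.cons {b : Bool} {k a : ℕ} {S : Finset ℕ} {T : Bool → Finset ℕ} (hT : Node a T S)
    (h : Comb b k (T (!b))) : Comb b (k + 1) S := by
  obtain ⟨a', p', h1, h2, h3⟩ := h
  obtain ⟨p, hp⟩ := hT.nonempty b
  refine ⟨fun i => Nat.casesOn i a a', fun i => Nat.casesOn i p p', ?_, ?_, ?_⟩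
  · rintro (_ | i) hi
    · exact hT.subset _ hp
    · exact hT.subset _ (h1 i (by omega))
  · rintro (_ | i) hi
    · exact hT.testBit _ _ hp
    · exact h2 i (by omega)
  · rintro (_ | i) (_ | j) hij hj
    · omega
    · exact hT.splits _ _ hp _ (h1 j (by omega))
    · omega
    · exact h3 i j (by omega) (by omega)

theorem exists_node {S : Finset ℕ} (hS : 2 ≤ S.card) :
    ∃ a T, Node a T S ∧ (T true).card + (T false).card = S.card := by
  classical
  have hex : ∃ a, ∃ x ∈ S, ∃ y ∈ S, Splits x y a := by
    obtain ⟨x, hx, y, hy, hxy⟩ := Finset.one_lt_card.1 (show 1 < S.card by omega)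
    obtain ⟨a, ha⟩ := exists_splits hxy
    exact ⟨a, x, hx, y, hy, ha⟩
  obtain ⟨x₀, hx₀, y₀, hy₀, h₀⟩ := Nat.find_spec hex
  have hmin : ∀ {x y b : ℕ}, x ∈ S → y ∈ S → Splits x y b → Nat.find hex ≤ b :=
    fun hx hy hb => Nat.find_min' hex ⟨_, hx, _, hy, hb⟩
  generalize Nat.find hex = a at h₀ hmin
  refine ⟨a, fun b => S.filter fun x => x.testBit a = b, ⟨fun b => Finset.filter_subset _ _, ?_,
    fun b x hx => (Finset.mem_filter.1 hx).2, ?_⟩, ?_⟩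
  · have := h₀.1
    intro b
    by_cases hb : x₀.testBit a = b
    · exact ⟨x₀, Finset.mem_filter.2 ⟨hx₀, hb⟩⟩
    · refine ⟨y₀, Finset.mem_filter.2 ⟨hy₀, ?_⟩⟩
      revert this hb
      cases x₀.testBit a <;> cases y₀.testBit a <;> cases b <;> simp
  · intro b x hx y hy
    rw [Finset.mem_filter] at hx hy
    have hxy : x.testBit a ≠ y.testBit a := by
      rw [hx.2, hy.2]
      cases b <;> simp
    obtain ⟨c, hc⟩ := exists_splits (x := x) (y := y) (fun e => hxy (by rw [e]))
    have := hmin hx.1 hy.1 hc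
    exact ⟨hxy, fun i hi => hc.2 i (by omega)⟩
  · simpa using Finset.card_filter_add_card_filter_not (s := S) fun x => x.testBit a = true

/-- Branch `S` at its first digit. One side `T b` has tree height smaller by one. The other has no
shorter `b`-comb, since a point of `T b` would add a tooth to it. With M = i + j + 1 the induction
closes by M^(h-1) + (M-1)^h ≤ M^h for h ≥ 1. -/
theorem card_le_of_not_comb {S : Finset ℕ} {h i j : ℕ} (hr : ¬ Rich (h + 1) S)
    (hi : ¬ Comb false (i + 1) S) (hj : ¬ Comb true (j + 1) S) : S.card ≤ (i + j + 1) ^ h := by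
  induction hn : S.card using Nat.strong_induction_on generalizing S h i j with
  | _ n ih =>
    subst hn
    by_cases hS : S.card ≤ 1
    · exact hS.trans (Nat.one_le_pow _ _ (by omega))
    obtain ⟨a, T, hT, hc⟩ := exists_node (S := S) (by omega)
    have comb_zero : ∀ b b', Comb b 0 (T b') := by
      intro b b'
      obtain ⟨x, hx⟩ := hT.nonempty b'
      exact ⟨fun _ => 0, fun _ => x, fun _ _ => hx, by omega, by omega⟩
    have card_pos : ∀ b, 0 < (T b).card := fun b => (hT.nonempty b).card_pos
    have p₁ := card_pos true
    have p₂ := card_pos false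
    cases h with
    | zero => exact absurd ⟨a, T, hT, fun b => hT.nonempty b⟩ hr
    | succ h =>
      obtain ⟨i, rfl⟩ : ∃ i', i = i' + 1 := Nat.exists_eq_succ_of_ne_zero (by
        rintro rfl
        exact hi (Comb.cons hT (comb_zero _ _)))
      obtain ⟨j, rfl⟩ : ∃ j', j = j' + 1 := Nat.exists_eq_succ_of_ne_zero (by
        rintro rfl
        exact hj (Comb.cons hT (comb_zero _ _)))
      have hb : ∃ b, ¬ Rich (h + 1) (T b) := by
        by_contra! hb
        exact hr ⟨a, T, hT, hb⟩
      have key : (i + 1 + (j + 1) + 1) ^ h + (i + j + 2) ^ (h + 1) ≤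
          (i + 1 + (j + 1) + 1) ^ (h + 1) := by
        have e : (i + j + 2) ^ h ≤ (i + 1 + (j + 1) + 1) ^ h := Nat.pow_le_pow_left (by omega) h
        calc (i + 1 + (j + 1) + 1) ^ h + (i + j + 2) ^ (h + 1)
            ≤ (i + 1 + (j + 1) + 1) ^ h + (i + j + 2) * (i + 1 + (j + 1) + 1) ^ h := by
              rw [pow_succ']; gcongr
          _ = _ := by ring
      obtain ⟨b, hb⟩ := hb
      have k₁ := ih (T b).card (by cases b <;> omega) hb
        (fun c => hi (c.mono (hT.subset _))) (fun c => hj (c.mono (hT.subset _))) rfl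
      have hr' : ¬ Rich (h + 1 + 1) (T (!b)) := fun c => hr (c.mono (hT.subset _))
      cases b with
      | false =>
        have k₂ := ih (T true).card (by omega) hr' (fun c => hi (Comb.cons hT c))
          (fun c => hj (c.mono (hT.subset _))) rfl
        rw [show i + (j + 1) + 1 = i + j + 2 by ring] at k₂
        omega
      | true =>
        have k₂ := ih (T false).card (by omega) hr' (fun c => hi (c.mono (hT.subset _)))
          (fun c => hj (Comb.cons hT c)) rfl
        rw [show i + 1 + j + 1 = i + j + 2 by ring] at k₂
        omega

/-- On a comb all directions agree. The pattern makes 123 and 134 good, and either value of φ(a₂,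
a₄) makes one of 124, 234 good; this is why the pattern leaves that pair free. -/
theorem hasFiveMinus_of_comb {φ : ℕ → ℕ → Bool} {S : Finset ℕ} {n D : ℕ} {b : Bool}
    (hD : ∀ x ∈ S, x < 2 ^ D)
    (hφ : ∀ a : ℕ → ℕ, (∀ i < n, a i < D) → (∀ i j, i < j → j < n → a i < a j) →
      ∃ i₁ i₂ i₃ i₄, i₁ < i₂ ∧ i₂ < i₃ ∧ i₃ < i₄ ∧ i₄ < n ∧ φ (a i₁) (a i₃) = true ∧
        φ (a i₁) (a i₄) = true ∧ φ (a i₂) (a i₃) = false ∧ φ (a i₃) (a i₄) = false)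
    (hS : Comb b n S) : HasFiveMinus φ S := by
  obtain ⟨a, p, hm, hb, hs⟩ := hS
  obtain ⟨i₁, i₂, i₃, i₄, h₁₂, h₂₃, h₃₄, h₄, e₁₃, e₁₄, e₂₃, e₃₄⟩ := hφ a
    (fun i hi => (hs i n hi le_rfl).lt_of_lt_two_pow (hD _ (hm _ hi.le)) (hD _ (hm _ le_rfl)))
    fun i j hij hj => (hs i j hij hj.le).lt (hs i n (hij.trans hj) le_rfl) (hs j n hj le_rfl)
  refine hasFiveMinus_of_caterpillar (hm i₁ (by omega)) (hm i₂ (by omega)) (hm i₃ (by omega))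
    (hm i₄ (by omega)) (hm n le_rfl) (hs _ _ ?_ ?_) (hs _ _ ?_ ?_) (hs _ _ ?_ ?_) (hs _ _ ?_ ?_)
    (hs _ _ ?_ ?_) (hs _ _ ?_ ?_) (hs _ _ ?_ ?_) (hs _ _ ?_ ?_) (hs _ _ ?_ ?_)
    (hs _ _ ?_ ?_) ?_ ?_
  all_goals first | omega | skip
  all_goals
    rw [hb i₁ (by omega), hb i₂ (by omega)]
    try rw [hb i₃ (by omega)]
    simp [Good, e₁₃, e₁₄, e₂₃, e₃₄]

theorem hasFiveMinus_of_card {φ : ℕ → ℕ → Bool} {S : Finset ℕ} {n D : ℕ}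
    (hD : ∀ x ∈ S, x < 2 ^ D)
    (hφ : ∀ a : ℕ → ℕ, (∀ i < n, a i < D) → (∀ i j, i < j → j < n → a i < a j) →
      ∃ i₁ i₂ i₃ i₄, i₁ < i₂ ∧ i₂ < i₃ ∧ i₃ < i₄ ∧ i₄ < n ∧ φ (a i₁) (a i₃) = true ∧
        φ (a i₁) (a i₄) = true ∧ φ (a i₂) (a i₃) = false ∧ φ (a i₃) (a i₄) = false)
    (hn : 0 < n) (hS : (2 * n) ^ 5 < S.card) : HasFiveMinus φ S := by
  by_contra h
  obtain ⟨m, rfl⟩ := Nat.exists_eq_succ_of_ne_zero hn.ne'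
  -- The exponent 5 is the height 6 of the forced tree minus one.
  have := card_le_of_not_comb (h := 5) (i := m) (j := m) (fun r => h (hasFiveMinus_of_rich r))
    (fun c => h (hasFiveMinus_of_comb hD hφ c)) (fun c => h (hasFiveMinus_of_comb hD hφ c))
  have h2 : (m + m + 1) ^ 5 ≤ (2 * (m + 1)) ^ 5 := Nat.pow_le_pow_left (by omega) 5
  exact absurd (this.trans h2) (not_le.2 hS)

end BinaryTree

/-! ### A random colouring of the pairs of digits. -/

namespace BinaryTree

-- The quadruples of pairs are disjoint, so avoiding the pattern leaves 15 of 16 possibilities on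
-- each of them independently, and free choice elsewhere.
open Finset in
theorem card_avoiding_le {X Q : Type} [Fintype X] [DecidableEq X] [Fintype Q] [DecidableEq Q]
    (e : Q × Fin 4 → X) (he : Function.Injective e) (pat : Fin 4 → Bool) :
    (univ.filter fun f : X → Bool => ∀ q, ∃ t, f (e (q, t)) ≠ pat t).card *
      16 ^ Fintype.card Q ≤ 15 ^ Fintype.card Q * 2 ^ Fintype.card X := by
  classical
  let C := {x : X // x ∉ Set.range e}
  have hC : Fintype.card C + 4 * Fintype.card Q = Fintype.card X := by
    have h1 := Fintype.card_subtype_compl (fun x : X => x ∈ Set.range e)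
    have h2 : Fintype.card {x : X // x ∈ Set.range e} = Fintype.card Q * 4 := by
      have := Fintype.card_congr (Equiv.ofInjective e he)
      rw [Fintype.card_prod, Fintype.card_fin] at this
      rw [this]
    have h3 := Fintype.card_subtype_le (fun x : X => x ∈ Set.range e)
    have h4 : Fintype.card C = Fintype.card {x : X // ¬ x ∈ Set.range e} :=
      Fintype.card_congr (Equiv.refl _)
    omega
  have hle : (univ.filter fun f : X → Bool => ∀ q, ∃ t, f (e (q, t)) ≠ pat t).card ≤
      ((Fintype.piFinset fun _ : Q => (univ : Finset (Fin 4 → Bool)).erase pat) ×ˢ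
        (univ : Finset (C → Bool))).card := by
    refine card_le_card_of_injOn (fun f => (fun q t => f (e (q, t)), fun c => f c.1)) ?_ ?_
    · intro f hf
      simp only [coe_filter, mem_univ, true_and, Set.mem_ofPred_eq] at hf
      simp only [coe_product, Set.mem_prod, mem_coe, Fintype.mem_piFinset, mem_erase, mem_univ,
        and_true]
      intro q hq
      obtain ⟨t, ht⟩ := hf q
      exact ht (congrFun hq t)
    · intro f _ g _ hfg
      rw [Prod.mk.injEq] at hfg
      funext x
      by_cases hx : x ∈ Set.range e
      · obtain ⟨⟨q, t⟩, rfl⟩ := hx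
        exact congrFun (congrFun hfg.1 q) t
      · exact congrFun hfg.2 ⟨x, hx⟩
  have hcard : ((Fintype.piFinset fun _ : Q => (univ : Finset (Fin 4 → Bool)).erase pat) ×ˢ
        (univ : Finset (C → Bool))).card = 15 ^ Fintype.card Q * 2 ^ Fintype.card C := by
    rw [card_product, Fintype.card_piFinset]
    simp [Finset.card_erase_of_mem]
  rw [hcard] at hle
  calc _ ≤ 15 ^ Fintype.card Q * 2 ^ Fintype.card C * 16 ^ Fintype.card Q := by gcongr
    _ = 15 ^ Fintype.card Q * (2 ^ Fintype.card C * 2 ^ (4 * Fintype.card Q)) := by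
      rw [show (16 : ℕ) = 2 ^ 4 by norm_num, ← pow_mul, mul_assoc]
    _ = _ := by rw [← pow_add, hC]

/-- The pairs of the quadruple with index `((x, y), t)`: any two of them are different. -/
def pairIndex (m x y : ℕ) : Fin 4 → ℕ × ℕ :=
  ![(x, 2 * m + y), (x, 3 * m + (x + y) % m), (m + x, 2 * m + y),
    (2 * m + y, 3 * m + (x + y) % m)]

/-- The blocks of length `m` containing the two entries reveal `t`. Any two of x, y and (x + y) mod
m determine the third, so each single pair recovers (x, y). -/
theorem pairIndex_injective {m x y x' y' : ℕ} {t t' : Fin 4} (hx : x < m) (hy : y < m)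
    (hx' : x' < m) (hy' : y' < m) (h : pairIndex m x y t = pairIndex m x' y' t') :
    x = x' ∧ y = y' ∧ t = t' := by
  have l := Nat.mod_lt (x + y) (show 0 < m by omega)
  have l' := Nat.mod_lt (x' + y') (show 0 < m by omega)
  have e : ∀ u v : ℕ, u < m → v < m →
      u + v < m ∧ (u + v) % m = u + v ∨ m ≤ u + v ∧ (u + v) % m = u + v - m := by
    intro u v hu hv
    by_cases h : u + v < m
    · exact Or.inl ⟨h, Nat.mod_eq_of_lt h⟩
    · right
      rw [Nat.mod_eq_sub_mod (by omega), Nat.mod_eq_of_lt (by omega)]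
      omega
  have e1 := e x y hx hy
  have e2 := e x' y' hx' hy'
  clear e
  unfold pairIndex at h
  generalize (x + y) % m = z at h l e1
  generalize (x' + y') % m = z' at h l' e2
  fin_cases t <;> fin_cases t' <;> simp at h ⊢ <;> omega

theorem pairIndex_lt {m x y : ℕ} (t : Fin 4) (hx : x < m) (hy : y < m) :
    (pairIndex m x y t).1 < 4 * m ∧ (pairIndex m x y t).2 < 4 * m := by
  have l := Nat.mod_lt (x + y) (show 0 < m by omega)
  fin_cases t <;> simp [pairIndex] <;> omega

-- Union bound by counting. Each of at most D^n injective sequences carries m² disjoint quadruples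
-- of pairs, so a fraction at most (15/16)^(m²) of the colourings is bad for it.
open Finset in
theorem exists_coloring {n m D : ℕ} (hm : 4 * m ≤ n)
    (h : D ^ n * 15 ^ (m * m) < 16 ^ (m * m)) :
    ∃ φ : ℕ → ℕ → Bool, ∀ a : ℕ → ℕ, (∀ i < n, a i < D) →
      (∀ i j, i < j → j < n → a i < a j) →
      ∃ i₁ i₂ i₃ i₄, i₁ < i₂ ∧ i₂ < i₃ ∧ i₃ < i₄ ∧ i₄ < n ∧ φ (a i₁) (a i₃) = true ∧
        φ (a i₁) (a i₄) = true ∧ φ (a i₂) (a i₃) = false ∧ φ (a i₃) (a i₄) = false := by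
  classical
  let X := Fin D × Fin D
  let Q := Fin m × Fin m
  let pat : Fin 4 → Bool := ![true, true, false, false]
  let e (a : Fin n → Fin D) (z : Q × Fin 4) : X :=
    (a ⟨(pairIndex m z.1.1 z.1.2 z.2).1,
        (pairIndex_lt z.2 z.1.1.2 z.1.2.2).1.trans_le hm⟩,
      a ⟨(pairIndex m z.1.1 z.1.2 z.2).2,
        (pairIndex_lt z.2 z.1.1.2 z.1.2.2).2.trans_le hm⟩)
  have he : ∀ a : Fin n → Fin D, Function.Injective a → Function.Injective (e a) := by
    rintro a ha ⟨⟨x, y⟩, t⟩ ⟨⟨x', y'⟩, t'⟩ hxy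
    obtain ⟨hxy₁, hxy₂⟩ := Prod.ext_iff.1 hxy
    have h1 := congrArg Fin.val (ha hxy₁)
    have h2 := congrArg Fin.val (ha hxy₂)
    obtain ⟨k1, k2, k3⟩ := pairIndex_injective x.2 y.2 x'.2 y'.2 (Prod.ext h1 h2)
    exact Prod.ext (Prod.ext (Fin.ext k1) (Fin.ext k2)) k3
  let bad (a : Fin n → Fin D) : Finset (X → Bool) :=
    univ.filter fun f => ∀ q, ∃ t, f (e a (q, t)) ≠ pat t
  let A : Finset (Fin n → Fin D) := univ.filter Function.Injective
  have hbad : ∀ a ∈ A, (bad a).card * 16 ^ (m * m) ≤ 15 ^ (m * m) * 2 ^ (D * D) := by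
    intro a ha
    have := card_avoiding_le (e a) (he a (mem_filter.1 ha).2) pat
    rwa [show Fintype.card Q = m * m by simp [Q], show Fintype.card X = D * D by simp [X]] at this
  have hA : A.card ≤ D ^ n := (card_filter_le _ _).trans (by simp)
  have hlt : (A.biUnion bad).card < (univ : Finset (X → Bool)).card := by
    have hu : (univ : Finset (X → Bool)).card = 2 ^ (D * D) := by simp [X]
    rw [hu]
    refine lt_of_mul_lt_mul_right (a := 16 ^ (m * m)) ?_ (Nat.zero_le _)
    calc (A.biUnion bad).card * 16 ^ (m * m)
        ≤ (∑ a ∈ A, (bad a).card) * 16 ^ (m * m) := by gcongr; exact card_biUnion_le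
      _ = ∑ a ∈ A, (bad a).card * 16 ^ (m * m) := sum_mul _ _ _
      _ ≤ A.card * (15 ^ (m * m) * 2 ^ (D * D)) := by
        rw [← smul_eq_mul]; exact sum_le_card_nsmul _ _ _ hbad
      _ ≤ D ^ n * (15 ^ (m * m) * 2 ^ (D * D)) := by gcongr
      _ = D ^ n * 15 ^ (m * m) * 2 ^ (D * D) := by ring
      _ < 16 ^ (m * m) * 2 ^ (D * D) := by gcongr
      _ = _ := mul_comm _ _
  obtain ⟨f, -, hf⟩ := exists_mem_notMem_of_card_lt_card hlt
  -- The default value is immaterial, since only digits below `D` occur in the sequences.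
  refine ⟨fun u v => if hu : u < D then if hv : v < D then f (⟨u, hu⟩, ⟨v, hv⟩) else false
    else false, fun a ha hmono => ?_⟩
  let a' : Fin n → Fin D := fun i => ⟨a i, ha i i.2⟩
  have ha' : a' ∈ A := by
    refine mem_filter.2 ⟨mem_univ _, fun i j hij => ?_⟩
    have hij' : a i = a j := congrArg Fin.val hij
    rcases lt_trichotomy i j with h | h | h
    · exact absurd hij' (hmono i j h j.2).ne
    · exact h
    · exact absurd hij' (hmono j i h i.2).ne'
  have hfa : f ∉ bad a' := fun hb => hf (mem_biUnion.2 ⟨a', ha', hb⟩)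
  simp only [bad, mem_filter, mem_univ, true_and, not_forall, not_exists, not_not] at hfa
  obtain ⟨⟨x, y⟩, hq⟩ := hfa
  have hx := x.2
  have hy := y.2
  have l := Nat.mod_lt (x.1 + y.1) (show 0 < m by omega)
  have k := fun i (hi : i < n) => ha i hi
  refine ⟨x, m + x, 2 * m + y, 3 * m + (x + y) % m, by omega, by omega, by omega, by omega,
    ?_, ?_, ?_, ?_⟩
  · beta_reduce
    rw [dif_pos (k _ (by omega)), dif_pos (k _ (by omega))]
    exact hq 0
  · beta_reduce
    rw [dif_pos (k _ (by omega)), dif_pos (k _ (by omega))]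
    exact hq 1
  · beta_reduce
    rw [dif_pos (k _ (by omega)), dif_pos (k _ (by omega))]
    exact hq 2
  · beta_reduce
    rw [dif_pos (k _ (by omega)), dif_pos (k _ (by omega))]
    exact hq 3

/-- Twelfth powers are compared because 2 · 15¹² ≤ 16¹². It then suffices that 12n²/1000 < m², which
follows from m ≥ n/8. -/
theorem pow_mul_lt_pow {n D : ℕ} (hn : 5 ≤ n) (hD : (D : ℝ) ≤ 2 ^ ((1 / 1000 : ℝ) * n)) :
    D ^ n * 15 ^ (n / 4 * (n / 4)) < 16 ^ (n / 4 * (n / 4)) := by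
  set m := n / 4 with hm
  have hm8 : n ≤ 8 * m := by omega
  have h1 : ((D : ℝ) ^ n) ^ 12 < (2 : ℝ) ^ (m * m) := by
    calc ((D : ℝ) ^ n) ^ 12 = (D : ℝ) ^ (n * 12) := by rw [pow_mul]
      _ ≤ ((2 : ℝ) ^ ((1 / 1000 : ℝ) * n)) ^ (n * 12) := by gcongr
      _ = (2 : ℝ) ^ ((1 / 1000 : ℝ) * n * (n * 12 : ℕ)) := by
        exact (Real.rpow_mul_natCast (by norm_num) _ _).symm
      _ < (2 : ℝ) ^ ((m * m : ℕ) : ℝ) := by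
        apply Real.rpow_lt_rpow_of_exponent_lt (by norm_num)
        have h8 : (n : ℝ) ≤ 8 * m := by exact_mod_cast hm8
        have h5 : (5 : ℝ) ≤ n := by exact_mod_cast hn
        push_cast
        nlinarith
      _ = (2 : ℝ) ^ (m * m) := Real.rpow_natCast _ _
  have h2 : (D ^ n) ^ 12 < 2 ^ (m * m) := by exact_mod_cast h1
  refine lt_of_pow_lt_pow_left₀ 12 (Nat.zero_le _) ?_
  calc (D ^ n * 15 ^ (m * m)) ^ 12 = (D ^ n) ^ 12 * (15 ^ 12) ^ (m * m) := by
        rw [mul_pow, pow_right_comm 15]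
    _ < 2 ^ (m * m) * (15 ^ 12) ^ (m * m) := by gcongr
    _ = (2 * 15 ^ 12) ^ (m * m) := by rw [mul_pow]
    _ ≤ (16 ^ 12) ^ (m * m) := by gcongr; norm_num
    _ = _ := pow_right_comm _ _ _

end BinaryTree

/-! ### Transfer to `KGraph` and monotonicity of the Erdős–Rogers function. -/

namespace KGraph

variable {k : ℕ} {V W : Type*}

theorem alpha_lt [Fintype V] {F : KGraph k W} {H : KGraph k V} {K : ℕ} (hK : 0 < K)
    (h : ∀ S : Finset V, K ≤ S.card → (H.induce S).ContainsCopy F) : alpha F H < K := by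
  have : alpha F H ≤ K - 1 := by
    refine csSup_le' ?_
    rintro m ⟨S, rfl, hS⟩
    by_contra hc
    exact hS (h S (by omega))
  omega

theorem le_alpha [Fintype V] {F : KGraph k W} {H : KGraph k V} {S : Finset V}
    (h : (H.induce S).IsFree F) : S.card ≤ alpha F H := by
  refine le_csSup ⟨Fintype.card V, ?_⟩ ⟨S, rfl, h⟩
  rintro m ⟨S, rfl, -⟩
  exact S.card_le_univ

/-- The restriction of the `4`-graph `BinaryTree.Edge φ` to the first `N` natural numbers. -/
def ofColoring (φ : ℕ → ℕ → Bool) (N : ℕ) : KGraph 4 (Fin N) where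
  edges := {e | e.card = 4 ∧ BinaryTree.Edge φ (e.map Fin.valEmbedding)}
  card_eq := fun _ he => he.1

theorem ofColoring_isFree (φ : ℕ → ℕ → Bool) (N : ℕ) :
    (ofColoring φ N).IsFree (complete 4 6) := by
  rintro ⟨ψ, hψ⟩
  obtain ⟨e, he, hc, hn⟩ := BinaryTree.exists_not_edge φ
    (S := (Finset.univ : Finset (Fin 6)).map (ψ.trans Fin.valEmbedding)) (by simp)
  obtain ⟨e', -, rfl⟩ := Finset.subset_map_iff.1 he
  rw [Finset.card_map] at hc
  rw [← Finset.map_map] at hn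
  exact hn (hψ e' hc).2

theorem mem_edges_fiveMinus {e : Finset (Fin 5)} (he : e ∈ fiveMinus.edges) :
    e = {0, 1, 2, 4} ∨ e = {0, 1, 3, 4} ∨ e = {0, 2, 3, 4} ∨ e = {1, 2, 3, 4} := by
  obtain ⟨h1, h2⟩ := he
  have h1' : e.card = 4 := h1
  have h2' : e ≠ {0, 1, 2, 3} := h2
  clear h1 h2
  revert e
  decide

theorem ofColoring_containsCopy {φ : ℕ → ℕ → Bool} {N : ℕ} {S : Finset (Fin N)}
    (h : BinaryTree.HasFiveMinus φ (S.map Fin.valEmbedding)) :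
    ((ofColoring φ N).induce S).ContainsCopy fiveMinus := by
  obtain ⟨x, hx, hS, h1, h2, h3, h4⟩ := h
  have hS' : ∀ i, ∃ v : {v // v ∈ S}, (v.1 : ℕ) = x i := by
    intro i
    obtain ⟨v, hv, e⟩ := Finset.mem_map.1 (hS i)
    exact ⟨⟨v, hv⟩, e⟩
  choose y hy using hS'
  have hinj : Function.Injective y := fun i j hij => hx (by rw [← hy, ← hy, hij])
  refine ⟨⟨y, hinj⟩, fun e he => ?_⟩
  have hmap : ((e.map ⟨y, hinj⟩).map
      (Function.Embedding.subtype fun v => v ∈ S)).map Fin.valEmbedding = e.image x := by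
    ext z
    simp [hy]
  refine ⟨?_, ?_⟩
  · rw [Finset.card_map, Finset.card_map]
    exact fiveMinus.card_eq e he
  · rw [hmap]
    rcases mem_edges_fiveMinus he with rfl | rfl | rfl | rfl <;>
      simpa [Finset.image_insert]

theorem exists_alpha_fiveMinus_lt {n D : ℕ} (hn : 5 ≤ n)
    (hD : (D : ℝ) ≤ 2 ^ ((1 / 1000 : ℝ) * n)) :
    ∃ H : KGraph 4 (Fin (2 ^ D)), H.IsFree (complete 4 6) ∧
      alpha fiveMinus H < 2 ^ 5 * n ^ 5 + 1 := by
  obtain ⟨φ, hφ⟩ := BinaryTree.exists_coloring (n := n) (m := n / 4) (by omega)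
    (BinaryTree.pow_mul_lt_pow hn hD)
  refine ⟨ofColoring φ _, ofColoring_isFree φ _, alpha_lt (Nat.succ_pos _) fun S hS => ?_⟩
  refine ofColoring_containsCopy (BinaryTree.hasFiveMinus_of_card (n := n) (D := D) ?_ hφ
    (by omega) ?_)
  · intro x hx
    obtain ⟨v, -, rfl⟩ := Finset.mem_map.1 hx
    exact v.2
  · rw [Finset.card_map, mul_pow]
    exact hS

/-- The pullback of a `k`-graph along an embedding. -/
def comap (f : W ↪ V) (H : KGraph k V) : KGraph k W where
  edges := {e | e.map f ∈ H.edges}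
  card_eq := fun e he => by
    have h := H.card_eq _ he
    rwa [Finset.card_map] at h

theorem IsFree.comap {U : Type*} {G : KGraph k U} {H : KGraph k V} (h : H.IsFree G) (f : W ↪ V) :
    (H.comap f).IsFree G := by
  rintro ⟨ψ, hψ⟩
  refine h ⟨ψ.trans f, fun e he => ?_⟩
  rw [← Finset.map_map]
  exact hψ e he

theorem alpha_comap_le {U : Type*} [Fintype V] [Fintype W] (F : KGraph k U) (H : KGraph k V)
    (f : W ↪ V) : alpha F (H.comap f) ≤ alpha F H := by
  refine csSup_le' ?_
  rintro m ⟨S, rfl, hS⟩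
  rw [← Finset.card_map f]
  refine le_alpha ?_
  rintro ⟨ψ, hψ⟩
  have hg : ∀ u : U, ∃ w : {w // w ∈ S}, f w.1 = (ψ u).1 := by
    intro u
    obtain ⟨w, hw, e⟩ := Finset.mem_map.1 (ψ u).2
    exact ⟨⟨w, hw⟩, e⟩
  choose g hg using hg
  have hinj : Function.Injective g := fun u v huv => ψ.injective (Subtype.ext (by
    rw [← hg, ← hg, huv]))
  refine hS ⟨⟨g, hinj⟩, fun e he => ?_⟩
  have := hψ e he
  have hmap : ((e.map ⟨g, hinj⟩).map (Function.Embedding.subtype fun w => w ∈ S)).map f =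
      (e.map ψ).map (Function.Embedding.subtype fun v => v ∈ S.map f) := by
    ext z
    simp only [Finset.mem_map, Function.Embedding.coeFn_mk, Function.Embedding.subtype_apply,
      exists_exists_and_eq_and]
    simp only [hg]
  show _ ∈ H.edges
  rw [hmap]
  exact this

theorem erdosRogers_le {U : Type*} {F : KGraph k W} {G : KGraph k U} {M N : ℕ} (hMN : N ≤ M)
    {H : KGraph k (Fin M)} (hH : H.IsFree G) : erdosRogers F G N ≤ alpha F H :=
  (Nat.sInf_le (⟨H.comap (Fin.castLEEmb hMN), hH.comap _, rfl⟩ :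
    alpha F (H.comap (Fin.castLEEmb hMN)) ∈
      {m : ℕ | ∃ H : KGraph k (Fin N), H.IsFree G ∧ alpha F H = m})).trans (alpha_comap_le _ _ _)

theorem le_erdosRogers {U : Type*} {F : KGraph k W} {G : KGraph k U} {N t : ℕ}
    (hG : G.edges.Nonempty)
    (h : ∀ H : KGraph k (Fin N), H.IsFree G → t ≤ alpha F H) : t ≤ erdosRogers F G N := by
  -- The edgeless graph is `G`-free because `G` has an edge; without any `G`-free graph the infimum
  -- would take the default value 0.
  refine le_csInf ?_ ?_
  · refine ⟨_, ⟨∅, by simp⟩, ?_, rfl⟩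
    rintro ⟨ψ, hψ⟩
    obtain ⟨e, he⟩ := hG
    exact hψ e he
  · rintro m ⟨H, hH, rfl⟩
    exact h H hH

end KGraph

/-! ### Ramsey bounds by Erdős–Rado stepping up. -/

namespace Ramsey

variable {V : Type*}

/-- Every two-colouring of the `k`-subsets of an `N`-set has a homogeneous `s`-set of the first
colour or a homogeneous `t`-set of the second colour. -/
def Arrow (V : Type*) (k N s t : ℕ) : Prop :=
  ∀ X : Finset V, N ≤ X.card → ∀ c : Finset V → Prop,
    (∃ A ⊆ X, A.card = s ∧ ∀ e ⊆ A, e.card = k → c e) ∨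
    ∃ B ⊆ X, B.card = t ∧ ∀ e ⊆ B, e.card = k → ¬ c e

theorem Arrow.mono {k N N' s t : ℕ} (h : Arrow V k N s t) (hN : N ≤ N') : Arrow V k N' s t :=
  fun X hX c => h X (hN.trans hX) c

theorem Arrow.swap {k N s t : ℕ} (h : Arrow V k N s t) : Arrow V k N t s := by
  intro X hX c
  rcases h X hX fun e => ¬ c e with h | ⟨A, hA, hc, h⟩
  · exact Or.inr h
  · exact Or.inl ⟨A, hA, hc, fun e he hk => not_not.1 (h e he hk)⟩

open Finset in
theorem forall_pair_insert [DecidableEq V] {P : Finset V → Prop} {v : V} {A : Finset V}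
    (hA : ∀ e ⊆ A, e.card = 2 → P e) (hv : ∀ w ∈ A, P {v, w}) :
    ∀ e ⊆ insert v A, e.card = 2 → P e := by
  intro e he hc
  by_cases hve : v ∈ e
  · obtain ⟨w, hw⟩ := card_eq_one.1 (show (e.erase v).card = 1 by
      rw [card_erase_of_mem hve, hc])
    have hwe : w ∈ e.erase v := by rw [hw]; exact mem_singleton_self w
    rw [← insert_erase hve, hw]
    exact hv w ((mem_insert.1 (he (mem_of_mem_erase hwe))).resolve_left (ne_of_mem_erase hwe))
  · exact hA e ((subset_insert_iff_of_notMem hve).1 he) hc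

open Finset in
theorem arrow_two_add {M N s t : ℕ} (hM : 0 < M) (h₁ : Arrow V 2 M s (t + 1))
    (h₂ : Arrow V 2 N (s + 1) t) : Arrow V 2 (M + N) (s + 1) (t + 1) := by
  classical
  intro X hX c
  obtain ⟨v, hv⟩ : X.Nonempty := card_pos.1 (by omega)
  have hs := card_filter_add_card_filter_not (s := X.erase v) fun w => c {v, w}
  rw [card_erase_of_mem hv] at hs
  have sub : ∀ (p : V → Prop) [DecidablePred p] {A : Finset V}, A ⊆ (X.erase v).filter p →
      v ∉ A ∧ insert v A ⊆ X ∧ ∀ w ∈ A, p w := by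
    intro p _ A hA
    refine ⟨fun h => ?_, insert_subset hv fun w hw => ?_, fun w hw => (mem_filter.1 (hA hw)).2⟩
    · exact absurd rfl (ne_of_mem_erase (mem_filter.1 (hA h)).1)
    · exact mem_of_mem_erase (mem_filter.1 (hA hw)).1
  rcases le_or_gt M ((X.erase v).filter fun w => c {v, w}).card with h | h
  · rcases h₁ _ h c with ⟨A, hA, hc, hAc⟩ | ⟨B, hB, hc, hBc⟩
    · obtain ⟨k1, k2, k3⟩ := sub _ hA
      exact Or.inl ⟨insert v A, k2, by rw [card_insert_of_notMem k1, hc],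
        forall_pair_insert hAc k3⟩
    · exact Or.inr ⟨B, (hB.trans (filter_subset _ _)).trans (erase_subset _ _), hc, hBc⟩
  · rcases h₂ ((X.erase v).filter fun w => ¬ c {v, w}) (by omega) c with
      ⟨A, hA, hc, hAc⟩ | ⟨B, hB, hc, hBc⟩
    · exact Or.inl ⟨A, (hA.trans (filter_subset _ _)).trans (erase_subset _ _), hc, hAc⟩
    · obtain ⟨k1, k2, k3⟩ := sub _ hB
      exact Or.inr ⟨insert v B, k2, by rw [card_insert_of_notMem k1, hc],
        forall_pair_insert hBc k3⟩

theorem arrow_two_one (t : ℕ) : Arrow V 2 1 1 t := by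
  intro X hX c
  obtain ⟨v, hv⟩ : X.Nonempty := Finset.card_pos.1 (by omega)
  refine Or.inl ⟨{v}, by simpa, by simp, fun e he hc => ?_⟩
  have := Finset.card_le_card he
  rw [Finset.card_singleton] at this
  omega

theorem arrow_two (s t : ℕ) : Arrow V 2 ((s + t).choose s) (s + 1) (t + 1) := by
  induction s generalizing t with
  | zero => simpa using arrow_two_one (V := V) (t + 1)
  | succ s ihs =>
    induction t with
    | zero => simpa using (arrow_two_one (V := V) (s + 1 + 1)).swap
    | succ t iht =>
      have h := arrow_two_add (Nat.choose_pos (by omega)) (ihs (t + 1)) iht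
      rw [show s + 1 + (t + 1) = (s + t + 1) + 1 by ring, Nat.choose_succ_succ]
      rw [show s + (t + 1) = s + t + 1 by ring, show s + 1 + t = s + t + 1 by ring] at h
      exact h

open Finset in
/-- The end-homogeneous sequences of Erdős and Rado: the colour of an `(r + 2)`-subset of `Y` is
determined by an `(r + 1)`-subset of it, and so is that of an `(r + 1)`-subset of `Y` together
with an element of `Z`. -/
theorem exists_endHomogeneous [DecidableEq V] {X : Finset V} (c : Finset V → Prop) (r q m : ℕ)
    (hq : ∀ i < m, i.choose r ≤ q) (hX : 2 ^ ((q + 1) * m) ≤ X.card) (i : ℕ) (hi : i ≤ m) :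
    ∃ (Y Z : Finset V) (d : Finset V → Prop), Y ⊆ X ∧ Z ⊆ X ∧ Disjoint Y Z ∧ Y.card = i ∧
      2 ^ ((q + 1) * (m - i)) ≤ Z.card ∧
      (∀ f ⊆ Y, f.card = r + 1 → ∀ z ∈ Z, (c (insert z f) ↔ d f)) ∧
      ∀ e ⊆ Y, e.card = r + 2 → ∃ f ⊆ e, f.card = r + 1 ∧ (c e ↔ d f) := by
  classical
  induction i with
  | zero =>
    refine ⟨∅, X, fun _ => False, empty_subset _, Subset.rfl, disjoint_empty_left _, rfl, hX,
      fun f hf hc => ?_, fun e he hc => ?_⟩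
    · rw [subset_empty.1 hf] at hc
      simp at hc
    · rw [subset_empty.1 he] at hc
      simp at hc
  | succ i ih =>
    obtain ⟨Y, Z, d, hY, hZ, hd, hYc, hZc, h₁, h₂⟩ := ih (by omega)
    obtain ⟨z₀, hz₀⟩ : Z.Nonempty := card_pos.1 ((Nat.two_pow_pos _).trans_le hZc)
    have hzY : z₀ ∉ Y := fun h => disjoint_left.1 hd h hz₀
    -- Move `z₀` into `Y` and keep the largest class of points `z` with the same colours on all sets
    -- {z, z₀} ∪ g. There are at most 2^q classes; one more factor 2 pays for removing `z₀`.
    let F (z : V) : Finset (Finset V) := (powersetCard r Y).filter fun g => c (insert z (insert z₀ g))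
    obtain ⟨G, -, hG⟩ := exists_le_card_fiber_of_mul_le_card_of_maps_to
      (s := Z.erase z₀) (t := (powersetCard r Y).powerset) (f := F)
      (n := 2 ^ ((q + 1) * (m - (i + 1))))
      (fun z _ => mem_powerset.2 (filter_subset _ _)) ⟨∅, by simp⟩ (by
        rw [card_powerset, card_powersetCard, card_erase_of_mem hz₀, hYc]
        have e1 : 2 ^ i.choose r ≤ 2 ^ q := Nat.pow_le_pow_right (by norm_num) (hq i (by omega))
        have e2 : (q + 1) * (m - i) = q + (q + 1) * (m - (i + 1)) + 1 := by
          rw [show m - i = m - (i + 1) + 1 by omega]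
          ring
        have e3 : 2 ^ i.choose r * 2 ^ ((q + 1) * (m - (i + 1))) ≤
            2 ^ (q + (q + 1) * (m - (i + 1))) := by
          rw [pow_add]
          exact Nat.mul_le_mul_right _ e1
        rw [e2, pow_succ] at hZc
        have e4 := Nat.two_pow_pos (q + (q + 1) * (m - (i + 1)))
        omega)
    refine ⟨insert z₀ Y, (Z.erase z₀).filter fun z => F z = G,
      fun f => if z₀ ∈ f then f.erase z₀ ∈ G else d f, insert_subset (hZ hz₀) hY,
      ((filter_subset _ _).trans (erase_subset _ _)).trans hZ, ?_,
      by rw [card_insert_of_notMem hzY, hYc], hG, ?_, ?_⟩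
    · rw [disjoint_left]
      intro y hy hyZ
      obtain ⟨hyZ, -⟩ := mem_filter.1 hyZ
      rcases mem_insert.1 hy with rfl | hy
      · exact absurd rfl (ne_of_mem_erase hyZ)
      · exact disjoint_left.1 hd hy (mem_of_mem_erase hyZ)
    · intro f hf hc z hz
      obtain ⟨hz, hzG⟩ := mem_filter.1 hz
      by_cases hzf : z₀ ∈ f
      · have hg : f.erase z₀ ∈ powersetCard r Y := by
          rw [mem_powersetCard, card_erase_of_mem hzf, hc]
          exact ⟨(erase_subset_erase z₀ hf).trans (erase_insert_subset _ _), rfl⟩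
        simp only [hzf, if_true, ← hzG, F, mem_filter, hg, true_and, insert_erase hzf]
      · simp only [hzf, if_false]
        exact h₁ f ((subset_insert_iff_of_notMem hzf).1 hf) hc z (mem_of_mem_erase hz)
    · intro e he hc
      by_cases hze : z₀ ∈ e
      · have hf : (e.erase z₀).card = r + 1 := by rw [card_erase_of_mem hze, hc]; rfl
        refine ⟨e.erase z₀, erase_subset _ _, hf, ?_⟩
        have := h₁ (e.erase z₀) ((erase_subset_erase z₀ he).trans (erase_insert_subset _ _)) hf
          z₀ hz₀
        rw [insert_erase hze] at this
        simpa using this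
      · obtain ⟨f, hf, hfc, hcd⟩ := h₂ e ((subset_insert_iff_of_notMem hze).1 he) hc
        refine ⟨f, hf, hfc, ?_⟩
        beta_reduce
        rw [if_neg fun h => hze (hf h)]
        exact hcd

-- Apply the hypothesis to the derived colouring `d` on an end-homogeneous set of size `m`. A
-- leftover point `z` can be added to the homogeneous set, which gains one in both parameters.
open Finset in
theorem Arrow.succ {r m s t : ℕ} (h : Arrow V (r + 1) m s t) :
    Arrow V (r + 2) (2 ^ ((m ^ r + 1) * m)) (s + 1) (t + 1) := by
  classical
  intro X hX c
  obtain ⟨Y, Z, d, hY, hZ, hd, hYc, hZc, h₁, h₂⟩ := exists_endHomogeneous c r (m ^ r) m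
    (fun i hi => (Nat.choose_le_pow i r).trans (Nat.pow_le_pow_left hi.le r)) hX m le_rfl
  obtain ⟨z, hz⟩ : Z.Nonempty := card_pos.1 ((Nat.two_pow_pos _).trans_le hZc)
  have key : ∀ A ⊆ Y, z ∉ A ∧ insert z A ⊆ X ∧ ∀ e ⊆ insert z A, e.card = r + 2 →
      ∃ f ⊆ A, f.card = r + 1 ∧ (c e ↔ d f) := by
    intro A hA
    refine ⟨fun h => disjoint_left.1 hd (hA h) hz, insert_subset (hZ hz) (hA.trans hY),
      fun e he hc => ?_⟩
    by_cases hze : z ∈ e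
    · have hf : (e.erase z).card = r + 1 := by rw [card_erase_of_mem hze, hc]; rfl
      have hfA := (erase_subset_erase z he).trans (erase_insert_subset _ _)
      refine ⟨e.erase z, hfA, hf, ?_⟩
      have := h₁ (e.erase z) (hfA.trans hA) hf z hz
      rwa [insert_erase hze] at this
    · have heA := (subset_insert_iff_of_notMem hze).1 he
      obtain ⟨f, hf, hfc, hcd⟩ := h₂ e (heA.trans hA) hc
      exact ⟨f, hf.trans heA, hfc, hcd⟩
  rcases h Y hYc.ge d with ⟨A, hA, hc, hAc⟩ | ⟨B, hB, hc, hBc⟩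
  · obtain ⟨k1, k2, k3⟩ := key A hA
    refine Or.inl ⟨insert z A, k2, by rw [card_insert_of_notMem k1, hc], fun e he hec => ?_⟩
    obtain ⟨f, hf, hfc, hcd⟩ := k3 e he hec
    exact hcd.2 (hAc f hf hfc)
  · obtain ⟨k1, k2, k3⟩ := key B hB
    refine Or.inr ⟨insert z B, k2, by rw [card_insert_of_notMem k1, hc], fun e he hec => ?_⟩
    obtain ⟨f, hf, hfc, hcd⟩ := k3 e he hec
    exact fun hce => hBc f hf hfc (hcd.1 hce)

theorem arrow_four {T : ℕ} (hT : 3 ≤ T) : Arrow V 4 (2 ^ 2 ^ (8 * T ^ 6)) 6 T := by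
  obtain ⟨t, rfl⟩ := Nat.exists_eq_add_of_le' hT
  -- Two steps up add 2 to each parameter, so the targets 6 and T = t + 3 start from 4 and t + 1.
  have h2 : Arrow V 2 ((t + 3) ^ 3) 4 (t + 1) :=
    (arrow_two 3 t).mono (by rw [add_comm]; exact Nat.choose_le_pow _ _)
  have h4 := h2.succ.succ
  refine h4.mono (Nat.pow_le_pow_right (by norm_num) ?_)
  set u := (t + 3) ^ 3 with hu
  have hu1 : 1 ≤ u := Nat.one_le_pow _ _ (by omega)
  set M := 2 ^ ((u ^ 1 + 1) * u) with hM
  have hM2 : 2 ≤ M := by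
    calc 2 = 2 ^ 1 := rfl
      _ ≤ M := Nat.pow_le_pow_right (by norm_num) (by nlinarith)
  have h1 : M ^ 2 + 1 ≤ M ^ 3 := by nlinarith [Nat.mul_le_mul hM2 hM2]
  calc (M ^ 2 + 1) * M ≤ M ^ 3 * M := Nat.mul_le_mul_right _ h1
    _ = M ^ 4 := (pow_succ _ _).symm
    _ = 2 ^ (4 * ((u ^ 1 + 1) * u)) := by rw [hM, ← pow_mul, mul_comm]
    _ ≤ 2 ^ (8 * (t + 3) ^ 6) := by
      refine Nat.pow_le_pow_right (by norm_num) ?_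
      rw [show (t + 3) ^ 6 = u ^ 2 by rw [hu, ← pow_mul], pow_one]
      nlinarith

end Ramsey

/-! ### The two bounds in terms of log log N. -/

namespace KGraph

theorem le_alpha_fiveMinus {N T : ℕ} (hT : 3 ≤ T) (hN : 2 ^ 2 ^ (8 * T ^ 6) ≤ N)
    {H : KGraph 4 (Fin N)} (hH : H.IsFree (complete 4 6)) : T ≤ alpha fiveMinus H := by
  rcases Ramsey.arrow_four hT (Finset.univ : Finset (Fin N)) (by simpa using hN)
    -- A homogeneous 6-set of edges is a forbidden K₆; an independent set contains no 5⁻.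
    (fun e => e ∈ H.edges) with ⟨A, -, hc, hA⟩ | ⟨B, -, hc, hB⟩
  · refine absurd ⟨(A.orderEmbOfFin hc).toEmbedding, fun e he => hA _ ?_ ?_⟩ hH
    · intro x hx
      obtain ⟨i, -, rfl⟩ := Finset.mem_map.1 hx
      exact A.orderEmbOfFin_mem hc i
    · rw [Finset.card_map]
      exact he
  · rw [← hc]
    refine le_alpha ?_
    rintro ⟨ψ, hψ⟩
    have he : ({0, 1, 2, 4} : Finset (Fin 5)) ∈ fiveMinus.edges :=
      ⟨show ({0, 1, 2, 4} : Finset (Fin 5)).card = 4 by decide,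
        show ({0, 1, 2, 4} : Finset (Fin 5)) ≠ {0, 1, 2, 3} by decide⟩
    refine hB _ ?_ ?_ (hψ _ he)
    · intro x hx
      obtain ⟨y, -, rfl⟩ := Finset.mem_map.1 hx
      exact y.2
    · rw [Finset.card_map, Finset.card_map]
      exact fiveMinus.card_eq _ he

end KGraph

namespace KGraph

theorem complete_edges_nonempty : (complete 4 6).edges.Nonempty :=
  ⟨{0, 1, 2, 3}, show ({0, 1, 2, 3} : Finset (Fin 6)).card = 4 by decide⟩

theorem two_pow_le_of_le_logb_logb {N k : ℕ} (hN : 4 ≤ N)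
    (h : (k : ℝ) ≤ Real.logb 2 (Real.logb 2 N)) : 2 ^ 2 ^ k ≤ N := by
  have hN' : (4 : ℝ) ≤ N := by exact_mod_cast hN
  have h0 : 0 < Real.logb 2 N := Real.logb_pos (by norm_num) (by linarith)
  rw [Real.le_logb_iff_rpow_le (by norm_num) h0, Real.rpow_natCast] at h
  have h' : ((2 ^ k : ℕ) : ℝ) ≤ Real.logb 2 N := by exact_mod_cast h
  rw [Real.le_logb_iff_rpow_le (by norm_num) (by linarith), Real.rpow_natCast] at h'
  exact_mod_cast h'

theorem rpow_le_erdosRogers {N : ℕ} (hN : 4 ≤ N)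
    (h : (512 : ℝ) ^ 7 ≤ Real.logb 2 (Real.logb 2 N)) :
    Real.logb 2 (Real.logb 2 N) ^ (1 / 7 : ℝ) ≤
      (erdosRogers fiveMinus (complete 4 6) N : ℝ) := by
  set L := Real.logb 2 (Real.logb 2 N) with hL
  have hL0 : 0 ≤ L := le_trans (by positivity) h
  -- With T = ⌈u⌉ ≤ 2u, the Ramsey exponent 8T⁶ is at most 512u⁶, which is at most u⁷ = L once u ≥
  -- 512.
  set u := L ^ (1 / 7 : ℝ) with hu
  have hu7 : u ^ 7 = L := by
    rw [hu, ← Real.rpow_natCast, ← Real.rpow_mul hL0]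
    norm_num
  have hu0 : 0 ≤ u := Real.rpow_nonneg hL0 _
  have hu512 : 512 ≤ u := by
    rw [← hu7] at h
    exact le_of_pow_le_pow_left₀ (by norm_num) hu0 h
  have hT : u ≤ (⌈u⌉₊ : ℝ) := Nat.le_ceil u
  have hT' : (⌈u⌉₊ : ℝ) ≤ 2 * u := by linarith [Nat.ceil_lt_add_one hu0]
  have h3 : 3 ≤ ⌈u⌉₊ := by
    have : ((3 : ℕ) : ℝ) ≤ (⌈u⌉₊ : ℝ) := by
      push_cast
      linarith
    exact_mod_cast this
  have hNT : 2 ^ 2 ^ (8 * ⌈u⌉₊ ^ 6) ≤ N := by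
    refine two_pow_le_of_le_logb_logb hN ?_
    rw [← hL, ← hu7]
    push_cast
    calc 8 * (⌈u⌉₊ : ℝ) ^ 6 ≤ 8 * (2 * u) ^ 6 := by gcongr
      _ = 512 * u ^ 6 := by ring
      _ ≤ u * u ^ 6 := by gcongr
      _ = u ^ 7 := by ring
  have hle : ⌈u⌉₊ ≤ erdosRogers fiveMinus (complete 4 6) N :=
    le_erdosRogers complete_edges_nonempty fun H hH => le_alpha_fiveMinus h3 hNT hH
  exact hT.trans (by exact_mod_cast hle)

theorem erdosRogers_le_rpow {N : ℕ} (hN : 4 ≤ N)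
    (h : 32 * (2000 : ℝ) ^ 5 ≤ Real.logb 2 (Real.logb 2 N)) :
    (erdosRogers fiveMinus (complete 4 6) N : ℝ) ≤ Real.logb 2 (Real.logb 2 N) ^ (6 : ℝ) := by
  have hN' : (4 : ℝ) ≤ N := by exact_mod_cast hN
  have h0 : 0 < Real.logb 2 N := Real.logb_pos (by norm_num) (by linarith)
  set L := Real.logb 2 (Real.logb 2 N) with hL
  have hL2 : 2 ≤ L := le_trans (by norm_num) h
  have hlog : Real.logb 2 N = 2 ^ L := (Real.rpow_logb (by norm_num) (by norm_num) h0).symm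
  -- This makes 2^(n/1000) at least 2 · 2^L = 2 log N, so its floor `D` is still at least log N.
  set n := ⌈1000 * (L + 1)⌉₊ with hn
  have hn1 : 1000 * (L + 1) ≤ n := Nat.le_ceil _
  have hn2 : (n : ℝ) ≤ 2000 * L := by
    have := Nat.ceil_lt_add_one (show 0 ≤ 1000 * (L + 1) by linarith)
    linarith
  have hn5 : 5 ≤ n := by
    have : ((5 : ℕ) : ℝ) ≤ (n : ℝ) := by
      push_cast
      linarith
    exact_mod_cast this
  set D := ⌊(2 : ℝ) ^ ((1 / 1000 : ℝ) * n)⌋₊ with hD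
  have hDle : (D : ℝ) ≤ 2 ^ ((1 / 1000 : ℝ) * n) := Nat.floor_le (by positivity)
  have hDge : Real.logb 2 N ≤ D := by
    have h1 : (2 : ℝ) ^ ((1 / 1000 : ℝ) * n) < D + 1 := Nat.lt_floor_add_one _
    have h2 : (2 : ℝ) ^ (L + 1) ≤ 2 ^ ((1 / 1000 : ℝ) * n) :=
      Real.rpow_le_rpow_of_exponent_le (by norm_num) (by linarith)
    have h3 : (2 : ℝ) ^ (L + 1) = 2 ^ L * 2 := by
      rw [Real.rpow_add (by norm_num), Real.rpow_one]
    have h4 : (1 : ℝ) ≤ 2 ^ L := Real.one_le_rpow (by norm_num) (by linarith)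
    rw [hlog]
    linarith
  have hND : N ≤ 2 ^ D := by
    rw [Real.logb_le_iff_le_rpow (by norm_num) (by linarith), Real.rpow_natCast] at hDge
    exact_mod_cast hDge
  obtain ⟨H, hH, hα⟩ := exists_alpha_fiveMinus_lt hn5 hDle
  have hle : erdosRogers fiveMinus (complete 4 6) N ≤ 2 ^ 5 * n ^ 5 :=
    (erdosRogers_le hND hH).trans (Nat.lt_succ_iff.1 hα)
  calc (erdosRogers fiveMinus (complete 4 6) N : ℝ) ≤ 2 ^ 5 * (n : ℝ) ^ 5 := by exact_mod_cast hle
    _ ≤ 2 ^ 5 * (2000 * L) ^ 5 := by gcongr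
    _ = 32 * 2000 ^ 5 * L ^ 5 := by ring
    _ ≤ L * L ^ 5 := by gcongr
    _ = L ^ 6 := by ring
    _ = L ^ (6 : ℝ) := by norm_cast

end KGraph

theorem theorem1p1 :
    (∃ a b : ℝ, 0 < a ∧ 0 < b ∧ ∃ N₀ : ℕ, ∀ N : ℕ, N₀ ≤ N →
      (Real.logb 2 (Real.logb 2 (N : ℝ))) ^ a ≤
          (KGraph.erdosRogers KGraph.fiveMinus (KGraph.complete 4 6) N : ℝ) ∧
      (KGraph.erdosRogers KGraph.fiveMinus (KGraph.complete 4 6) N : ℝ) ≤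
          (Real.logb 2 (Real.logb 2 (N : ℝ))) ^ b) ∧
    (∃ c : ℝ, 0 < c ∧ ∀ n : ℕ, 5 ≤ n →
      ∃ H : KGraph 4 (Fin (2 ^ ⌊(2 : ℝ) ^ (c * (n : ℝ))⌋₊)),
        H.IsFree (KGraph.complete 4 6) ∧
        KGraph.alpha KGraph.fiveMinus H < 2 ^ 5 * n ^ 5 + 1) := by
  refine ⟨⟨1 / 7, 6, by norm_num, by norm_num, ?_⟩, 1 / 1000, by norm_num, fun n hn =>
    KGraph.exists_alpha_fiveMinus_lt hn (Nat.floor_le (by positivity))⟩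
  have hlim : Filter.Tendsto (fun N : ℕ => Real.logb 2 (Real.logb 2 (N : ℝ))) Filter.atTop
      Filter.atTop :=
    (Real.tendsto_logb_atTop (by norm_num)).comp
      ((Real.tendsto_logb_atTop (by norm_num)).comp tendsto_natCast_atTop_atTop)
  refine Filter.eventually_atTop.1 ?_
  filter_upwards [Filter.eventually_ge_atTop 4, hlim.eventually_ge_atTop ((512 : ℝ) ^ 7),
    hlim.eventually_ge_atTop (32 * (2000 : ℝ) ^ 5)] with N h4 h1 h2
  exact ⟨KGraph.rpow_le_erdosRogers h4 h1, KGraph.erdosRogers_le_rpow h4 h2⟩
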